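/- Conventions. Let $d\ge 1$. Write $|\cdot|$ for the Euclidean norm on $\mathbb R^d$ and $\mathbb C^d$, $|x|_\infty=\max_j|x_j|$, and for $R>0$ put $Q_R=\{\xi\in\mathbb R^d:|\xi|_\infty\le R\}$ and $H_R(x)=\sup_{y\in Q_R}\langle x,y\rangle$ for $x\in\mathbb R^d$. For a multi-index $\alpha\in\mathbb N_0^d$ let $|\alpha|=\alpha_1+\dots+\alpha_d$ and $f^{(\alpha)}=D_1^{\alpha_1}\cdots D_d^{\alpha_d}f$ with $D_j=-i\,\partial/\partial x_j$. For $f$ in the Schwartz space $\mathcal S(\mathbb R^d)$ let $$\hat f(\xi)=\int_{\mathbb R^d}f(x)e^{-i\langle x,\xi\rangle}\,dx,\qquad \mathrm{Wig} f(x,\xi)=\int_{\mathbb R^d}f\left(x+\tfrac t2\right)\overline{f\left(x-\tfrac t2\right)}\,e^{-i\langle \xi,t\rangle}\,dt .$$ For a function $g$ on $\mathbb R^d$ let $R_g=\sup\{|x|_\infty:x\in\operatorname{supp}g\}\in[0,+\infty]$, with $R_g=0$ if $g=0$. For a measurable $F$ on $\mathbb R^{2d}$ let $\|F\|_{L^{p,q}}=\left(\int_{\mathbb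 R^d}\left(\int_{\mathbb R^d}|F(x,\xi)|^p\,dx\right)^{q/p}d\xi\right)^{1/q}$, where the $L^p$ or $L^q$ norm is replaced by the essential supremum if $p=\infty$ or $q=\infty$. Theorem. Let $1\le p,q\le+\infty$ and $R>0$. For a function $f:\mathbb R^d\to\mathbb C$ the following conditions are equivalent: (a) $f$ extends to an entire function on $\mathbb C^d$, again denoted by $f$, such that for every $k\in\mathbb N_0$ there is $C_k>0$ with $$|f(z)|\le C_k(1+|z|)^{-k}e^{H_R(\operatorname{Im} z)},\qquad z\in\mathbb C^d.$$ (b) $f\in\mathcal S(\mathbb R^d)$ and for every $\lambda>0$ there is $C_\lambda>0$ such that $$|f^{(\alpha)}(x)|\le C_\lambda R^{|\alpha|}(|\alpha|+1)^\lambda(1+|x|)^{-\lambda},\qquad x\in\mathbb R^d,\ \alpha\in\mathbb N_0^d.$$ (c) $f\in\mathcal S(\mathbb R^d)$ and $$\lim_{n\to+\infty}\left(\max_{|\alpha|=n}\|f^{(\alpha)}\|_{L^p}\right)^{1/n}=R_{\hat f}\le R.$$ (d) $f\in\mathcal S(\mathbb R^d)$ and $\operatorname{supp}\hat f\subseteq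 Q_R$. (e) $f\in\mathcal S(\mathbb R^d)$ and $$\lim_{n\to+\infty}\left\|\,|\xi|_\infty^n\,\mathrm{Wig} f(x,\xi)\right\|_{L^{p,q}}^{1/n}=R_{\hat f}\le R.$$ -/

import Mathlib

open MeasureTheory Filter Topology
open scoped ENNReal

noncomputable section

namespace RealPaleyWiener

/-- `|x|_∞ = max_j |x_j|`: the norm of the underlying tuple in `Fin d → ℝ`, which is the sup norm. -/
def supNorm {d : ℕ} (x : EuclideanSpace ℝ (Fin d)) : ℝ :=
  ‖WithLp.ofLp x‖

/-- The cube `Q_R = {ξ : |ξ|_∞ ≤ R}`. -/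
def cube (d : ℕ) (R : ℝ) : Set (EuclideanSpace ℝ (Fin d)) :=
  {ξ | supNorm ξ ≤ R}

/-- The supporting function `H_R(x) = sup {⟨x, y⟩ : y ∈ Q_R}` of the cube. -/
def cubeSupportFun {d : ℕ} (R : ℝ) (x : EuclideanSpace ℝ (Fin d)) : ℝ :=
  sSup ((fun y : EuclideanSpace ℝ (Fin d) => inner ℝ x y) '' cube d R)

/-- The inclusion of `ℝ^d` in `ℂ^d`. -/
def toComplex {d : ℕ} (x : EuclideanSpace ℝ (Fin d)) : EuclideanSpace ℂ (Fin d) :=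
  WithLp.toLp 2 fun j => (x j : ℂ)

/-- The vector `Im z` of imaginary parts of `z ∈ ℂ^d`. -/
def imPart {d : ℕ} (z : EuclideanSpace ℂ (Fin d)) : EuclideanSpace ℝ (Fin d) :=
  WithLp.toLp 2 fun j => (z j).im

/-- The function `f` belongs to the Schwartz space `𝓢(ℝ^d)`. -/
def IsSchwartz {d : ℕ} (f : EuclideanSpace ℝ (Fin d) → ℂ) : Prop :=
  ∃ g : SchwartzMap (EuclideanSpace ℝ (Fin d)) ℂ, (g : EuclideanSpace ℝ (Fin d) → ℂ) = f

/-- The operator `D_j = -i ∂/∂x_j`. -/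
def partialD {d : ℕ} (j : Fin d) (f : EuclideanSpace ℝ (Fin d) → ℂ) :
    EuclideanSpace ℝ (Fin d) → ℂ :=
  fun x => -Complex.I * fderiv ℝ f x (EuclideanSpace.single j 1)

/-- `f^(α) = D^α f = D_1^{α_1} ⋯ D_d^{α_d} f` for a multi-index `α`. -/
def multiD {d : ℕ} (α : Fin d → ℕ) (f : EuclideanSpace ℝ (Fin d) → ℂ) :
    EuclideanSpace ℝ (Fin d) → ℂ :=
  (List.finRange d).foldr (fun j g => (partialD j)^[α j] g) f

/-- The length `|α| = α_1 + ⋯ + α_d` of a multi-index. -/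
def multiLength {d : ℕ} (α : Fin d → ℕ) : ℕ :=
  ∑ j, α j

/-- The Fourier transform `∫ f(x) e^{-i⟨x, ξ⟩} dx`. -/
def fourierHat {d : ℕ} (f : EuclideanSpace ℝ (Fin d) → ℂ) (ξ : EuclideanSpace ℝ (Fin d)) : ℂ :=
  ∫ x, f x * Complex.exp (-Complex.I * ((inner ℝ x ξ : ℝ) : ℂ))

/-- The Wigner transform `∫ f(x + t/2) conj(f(x - t/2)) e^{-i⟨ξ, t⟩} dt` of `f`. -/
def wigner {d : ℕ} (f : EuclideanSpace ℝ (Fin d) → ℂ) (x ξ : EuclideanSpace ℝ (Fin d)) : ℂ :=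
  ∫ t, f (x + (1 / 2 : ℝ) • t) * (starRingEnd ℂ) (f (x - (1 / 2 : ℝ) • t)) *
    Complex.exp (-Complex.I * ((inner ℝ ξ t : ℝ) : ℂ))

/-- `R_g = sup {|x|_∞ : x ∈ supp g}`, as an element of `[0, ∞]` (so that it is `0` for `g = 0`);
`tsupport g` is the closure of `{x | g x ≠ 0}`. -/
def supportRadius {d : ℕ} (g : EuclideanSpace ℝ (Fin d) → ℂ) : ℝ≥0∞ :=
  ⨆ x ∈ tsupport g, ENNReal.ofReal (supNorm x)

/-- `max_{|α| = n} ‖f^(α)‖_{L^p}`; the set of these `α` is finite, so that the supremum in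
`[0, ∞]` is a maximum. -/
def maxDerivNorm {d : ℕ} (p : ℝ≥0∞) (f : EuclideanSpace ℝ (Fin d) → ℂ) (n : ℕ) : ℝ≥0∞ :=
  ⨆ (α : Fin d → ℕ) (_ : multiLength α = n), eLpNorm (multiD α f) p volume

/-- The mixed norm `‖F‖_{L^{p,q}}`: the `L^p` norm in the first variable `x`, then the `L^q` norm in
the second variable `ξ` (with essential suprema for infinite exponents). -/
def mixedNorm {d : ℕ} (p q : ℝ≥0∞)
    (F : EuclideanSpace ℝ (Fin d) → EuclideanSpace ℝ (Fin d) → ℂ) : ℝ≥0∞ :=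
  eLpNorm (fun ξ => eLpNorm (fun x => F x ξ) p volume) q volume

end RealPaleyWiener

end

open RealPaleyWiener

open scoped FourierTransform SchwartzMap LineDeriv

noncomputable section

namespace RealPaleyWiener

variable {d : ℕ}

/-! Condition (d) is the hub: each of the other conditions is proved equivalent to it. For a
Schwartz function it reads `BandLimited R g`; the factor `2π` there appears because `𝓕` has kernel
`e^{-2πi⟨x,ξ⟩}`.

Derivative bounds (b): on the Fourier side `D^α` multiplies by a monomial of size at most `R^|α|` on
the cube. Moving a weight `x_j` past `D^α` costs at most `|α|` terms of order `|α| - 1`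
(`exists_listD_schwartzX`), whence the polynomial factor. Conversely, the bounds for `D_j^n` make
`(|2πξ_j| / R)^n |𝓕 g ξ|` grow at most polynomially in `n`, so `𝓕 g` vanishes off the cube.

Growth rates (c) and (e): let `r` be the exact support radius. The upper bounds have rate `r`. For
(c), Plancherel on a set where some `|2πξ_j|` exceeds `s < r` bounds the `L²` norm below, and Hölder
transfers this to `L^p`. For (e), `wigner_eq` expresses the Wigner transform through the inverse
Fourier transform of `ζ ↦ 𝓕 g ζ · conj (𝓕 g (ξ/π - ζ))`. Hence it vanishes for `ξ` outside the cube,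
by convexity, and it does not vanish identically in `x` over a frequency where the Fourier transform
of `g` is nonzero.

Entire extensions (a): the Fourier–Laplace integral of a band-limited `g` is entire, and integration
by parts gives its decay. Conversely, moving one coordinate of integration into the complex plane
does not change the Fourier integral (`integral_shiftedIntegrand_eq`); a long imaginary shift then
forces `𝓕 f` to vanish off the cube. -/

/-! ### Derivatives and coordinate multiplications on the Fourier side -/

/-- The operator `D_j = -i ∂/∂x_j` on Schwartz functions. -/
def schwartzD (j : Fin d) (g : 𝓢(EuclideanSpace ℝ (Fin d), ℂ)) :
    𝓢(EuclideanSpace ℝ (Fin d), ℂ) :=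
  (-Complex.I) • ∂_{EuclideanSpace.single j (1 : ℝ)} g

/-- Multiplication of Schwartz functions by the coordinate `x_j`. -/
def schwartzX (j : Fin d) (g : 𝓢(EuclideanSpace ℝ (Fin d), ℂ)) :
    𝓢(EuclideanSpace ℝ (Fin d), ℂ) :=
  SchwartzMap.smulLeftCLM ℂ (inner ℝ · (EuclideanSpace.single j (1 : ℝ))) g

/-- The composition `D_{j_1} ⋯ D_{j_n}` for a list `[j_1, …, j_n]` of indices. -/
def listD (L : List (Fin d)) (g : 𝓢(EuclideanSpace ℝ (Fin d), ℂ)) :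
    𝓢(EuclideanSpace ℝ (Fin d), ℂ) :=
  L.foldr schwartzD g

lemma inner_single_one (x : EuclideanSpace ℝ (Fin d)) (j : Fin d) :
    inner ℝ x (EuclideanSpace.single j (1 : ℝ)) = x j := by
  simp [EuclideanSpace.inner_single_right]

lemma schwartzD_coe (j : Fin d) (g : 𝓢(EuclideanSpace ℝ (Fin d), ℂ)) :
    (schwartzD j g : EuclideanSpace ℝ (Fin d) → ℂ) = partialD j g := by
  ext x
  simp [schwartzD, partialD, SchwartzMap.lineDerivOp_apply_eq_fderiv]

lemma schwartzX_apply (j : Fin d) (g : 𝓢(EuclideanSpace ℝ (Fin d), ℂ))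
    (x : EuclideanSpace ℝ (Fin d)) : schwartzX j g x = (x j : ℂ) * g x := by
  rw [schwartzX, SchwartzMap.smulLeftCLM_apply_apply (by fun_prop)]
  simp [inner_single_one]

@[simp] lemma listD_nil (g : 𝓢(EuclideanSpace ℝ (Fin d), ℂ)) : listD [] g = g := rfl

@[simp] lemma listD_cons (j : Fin d) (L : List (Fin d)) (g : 𝓢(EuclideanSpace ℝ (Fin d), ℂ)) :
    listD (j :: L) g = schwartzD j (listD L g) := rfl

lemma listD_append (L M : List (Fin d)) (g : 𝓢(EuclideanSpace ℝ (Fin d), ℂ)) :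
    listD (L ++ M) g = listD L (listD M g) := by
  simp [listD]

/-- The list in which each index `j` occurs `α j` times. -/
def multiList (α : Fin d → ℕ) : List (Fin d) :=
  (List.finRange d).flatMap fun j => List.replicate (α j) j

lemma multiD_eq_listD (α : Fin d → ℕ) (g : 𝓢(EuclideanSpace ℝ (Fin d), ℂ)) :
    multiD α g = listD (multiList α) g := by
  have hrep (n : ℕ) (j : Fin d) (h : 𝓢(EuclideanSpace ℝ (Fin d), ℂ)) :
      (partialD j)^[n] h = listD (List.replicate n j) h := by
    induction n with
    | zero => rfl
    | succ n ih => rw [Function.iterate_succ_apply', ih, ← schwartzD_coe]; rfl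
  unfold multiD multiList
  induction List.finRange d with
  | nil => rfl
  | cons j L ih =>
    rw [List.foldr_cons, ih, hrep, List.flatMap_cons, listD_append]

lemma length_multiList (α : Fin d → ℕ) : (multiList α).length = multiLength α := by
  simp [multiList, multiLength, List.length_flatMap, ← List.sum_ofFn, List.ofFn_eq_map]

lemma prod_multiList (α : Fin d → ℕ) (c : Fin d → ℂ) :
    ((multiList α).map c).prod = ∏ j, c j ^ α j := by
  rw [multiList, List.map_flatMap, ← List.prod_ofFn, List.ofFn_eq_map]
  induction List.finRange d with
  | nil => rfl
  | cons j L ih => simp only [List.map_replicate] at ih ⊢; simp [List.flatMap_cons, ih]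

lemma fourier_schwartzD (j : Fin d) (g : 𝓢(EuclideanSpace ℝ (Fin d), ℂ))
    (ξ : EuclideanSpace ℝ (Fin d)) :
    𝓕 (schwartzD j g) ξ = ((2 * Real.pi * ξ j : ℝ) : ℂ) * 𝓕 g ξ := by
  rw [schwartzD, FourierTransform.fourier_smul, SchwartzMap.fourier_lineDerivOp_eq]
  simp only [smul_apply]
  rw [SchwartzMap.smulLeftCLM_apply_apply (by fun_prop), inner_single_one]
  simp only [smul_eq_mul, Complex.real_smul]
  push_cast
  linear_combination (-2 * Real.pi * (ξ j : ℂ) * 𝓕 g ξ) * Complex.I_mul_I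

lemma fourier_listD (L : List (Fin d)) (g : 𝓢(EuclideanSpace ℝ (Fin d), ℂ))
    (ξ : EuclideanSpace ℝ (Fin d)) :
    𝓕 (listD L g) ξ = (L.map fun j => ((2 * Real.pi * ξ j : ℝ) : ℂ)).prod * 𝓕 g ξ := by
  induction L with
  | nil => simp
  | cons j L ih => rw [listD_cons, fourier_schwartzD, ih, List.map_cons, List.prod_cons, ← mul_assoc]

lemma fourier_schwartzX (j : Fin d) (g : 𝓢(EuclideanSpace ℝ (Fin d), ℂ)) :
    𝓕 (schwartzX j g) =
      (Complex.I / (2 * Real.pi)) • ∂_{EuclideanSpace.single j (1 : ℝ)} (𝓕 g) := by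
  rw [SchwartzMap.lineDerivOp_fourier_eq, FourierTransform.fourier_smul, smul_smul]
  have : Complex.I / (2 * Real.pi) * -(2 * Real.pi * Complex.I) = 1 := by
    have : (Real.pi : ℂ) ≠ 0 := by exact_mod_cast Real.pi_ne_zero
    field_simp
    simp
  rw [this, one_smul]
  rfl

/-! ### Derivative estimates for band-limited functions -/

/-- The Fourier transform of `g` vanishes outside the cube of radius `r` (with respect to
angular frequencies). -/
def BandLimited (r : ℝ) (g : 𝓢(EuclideanSpace ℝ (Fin d), ℂ)) : Prop :=
  ∀ ξ, 𝓕 g ξ ≠ 0 → ∀ j, |2 * Real.pi * ξ j| ≤ r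

lemma BandLimited.mem_of_tsupport {r : ℝ} {g : 𝓢(EuclideanSpace ℝ (Fin d), ℂ)}
    (hg : BandLimited r g) {ξ : EuclideanSpace ℝ (Fin d)}
    (hξ : ξ ∈ tsupport (𝓕 g : 𝓢(EuclideanSpace ℝ (Fin d), ℂ))) (j : Fin d) :
    |2 * Real.pi * ξ j| ≤ r := by
  have hc : IsClosed {ξ : EuclideanSpace ℝ (Fin d) | |2 * Real.pi * ξ j| ≤ r} :=
    isClosed_le (by fun_prop) continuous_const
  exact closure_minimal (fun ξ hξ => hg ξ hξ j) hc hξ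

/-- Differentiating `𝓕 g` does not enlarge its support. This stability is what allows induction on
powers of a coordinate, both for real decay and for the entire extension. -/
lemma BandLimited.mul_coord {r : ℝ} {g : 𝓢(EuclideanSpace ℝ (Fin d), ℂ)}
    (hg : BandLimited r g) (j : Fin d) : BandLimited r (schwartzX j g) := by
  intro ξ hξ k
  refine hg.mem_of_tsupport (SchwartzMap.tsupport_lineDerivOp_subset
    (EuclideanSpace.single j (1 : ℝ)) (𝓕 g) (subset_tsupport _ ?_)) k
  rw [fourier_schwartzX] at hξ
  intro h
  exact hξ (by simp [h])

lemma norm_prod_map_le {r : ℝ} (L : List (Fin d)) (c : Fin d → ℝ) (hc : ∀ j, |c j| ≤ r) :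
    ‖(L.map fun j => (c j : ℂ)).prod‖ ≤ r ^ L.length := by
  induction L with
  | nil => simp
  | cons j L ih =>
    rw [List.map_cons, List.prod_cons, norm_mul, List.length_cons, pow_succ']
    have : ‖(c j : ℂ)‖ ≤ r := by simpa using hc j
    exact mul_le_mul this ih (norm_nonneg _) ((norm_nonneg _).trans this)

lemma BandLimited.norm_listD_le {r : ℝ} {g : 𝓢(EuclideanSpace ℝ (Fin d), ℂ)}
    (hg : BandLimited r g) (L : List (Fin d)) (x : EuclideanSpace ℝ (Fin d)) :
    ‖listD L g x‖ ≤ r ^ L.length * ∫ ξ, ‖𝓕 g ξ‖ := by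
  have h1 : listD L g x = 𝓕⁻ (𝓕 (listD L g) : 𝓢(EuclideanSpace ℝ (Fin d), ℂ)) x := by
    rw [FourierTransform.fourierInv_fourier_eq]
  rw [h1, SchwartzMap.fourierInv_coe, Real.fourierInv_eq, ← integral_const_mul]
  refine norm_integral_le_of_norm_le ((𝓕 g).integrable.norm.const_mul _) (.of_forall fun ξ => ?_)
  rw [Circle.norm_smul, fourier_listD, norm_mul]
  by_cases h : 𝓕 g ξ = 0
  · simp [h]
  · exact mul_le_mul_of_nonneg_right (norm_prod_map_le L _ (hg ξ h)) (norm_nonneg _)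

lemma schwartzD_schwartzX (i j : Fin d) (g : 𝓢(EuclideanSpace ℝ (Fin d), ℂ)) :
    schwartzD i (schwartzX j g) =
      schwartzX j (schwartzD i g) + if i = j then (-Complex.I) • g else 0 := by
  ext x
  have h : HasFDerivAt (schwartzX j g : EuclideanSpace ℝ (Fin d) → ℂ)
      ((x j : ℂ) • fderiv ℝ g x +
        (Complex.ofRealCLM.comp (EuclideanSpace.proj j : _ →L[ℝ] ℝ)).smulRight (g x)) x := by
    have h1 : HasFDerivAt (fun y : EuclideanSpace ℝ (Fin d) => (y j : ℂ))
        (Complex.ofRealCLM.comp (EuclideanSpace.proj j : _ →L[ℝ] ℝ)) x :=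
      (Complex.ofRealCLM.comp (EuclideanSpace.proj j : _ →L[ℝ] ℝ)).hasFDerivAt
    have h2 := h1.smul (g.hasFDerivAt x)
    refine h2.congr_of_eventuallyEq (.of_forall fun y => ?_)
    simp [schwartzX_apply]
  rw [add_apply, schwartzX_apply, schwartzD_coe, schwartzD_coe, partialD, partialD,
    h.fderiv]
  by_cases hij : i = j
  · subst hij
    simp
    ring
  · have : j ≠ i := fun h => hij h.symm
    simp [hij, this]
    ring

lemma schwartzD_add (i : Fin d) (g h : 𝓢(EuclideanSpace ℝ (Fin d), ℂ)) :
    schwartzD i (g + h) = schwartzD i g + schwartzD i h := by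
  simp [schwartzD, LineDeriv.lineDerivOp_add]

lemma schwartzD_smul (i : Fin d) (c : ℂ) (g : 𝓢(EuclideanSpace ℝ (Fin d), ℂ)) :
    schwartzD i (c • g) = c • schwartzD i g := by
  simp [schwartzD, LineDeriv.lineDerivOp_smul, smul_comm c]

/-- By the commutator of `D_j` and `x_j`, each occurrence of `j` in `L` contributes one term in
which that occurrence is deleted. The count `S.length ≤ L.length` is the source of the polynomial
factor in the estimates. -/
lemma exists_listD_schwartzX (j : Fin d) (L : List (Fin d)) :
    ∃ S : List (List (Fin d)), S.length ≤ L.length ∧ (∀ M ∈ S, M.length + 1 = L.length) ∧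
      ∀ g : 𝓢(EuclideanSpace ℝ (Fin d), ℂ), listD L (schwartzX j g) =
        schwartzX j (listD L g) + (-Complex.I) • (S.map fun M => listD M g).sum := by
  induction L with
  | nil => exact ⟨[], by simp, by simp, by simp⟩
  | cons i L ih =>
    obtain ⟨S, hS, hSL, hSg⟩ := ih
    have hsum (g : 𝓢(EuclideanSpace ℝ (Fin d), ℂ)) : schwartzD i (S.map fun M => listD M g).sum =
        ((S.map (i :: ·)).map fun M => listD M g).sum := by
      clear hS hSL hSg
      induction S with
      | nil => simp [schwartzD, LineDeriv.lineDerivOp_zero]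
      | cons M S ih => simp [schwartzD_add] at ih ⊢; rw [ih]
    refine ⟨(if i = j then [L] else []) ++ S.map (i :: ·), ?_, ?_, fun g => ?_⟩
    · split_ifs <;> simp <;> omega
    · intro M hM
      split_ifs at hM <;> simp at hM <;> grind
    · rw [listD_cons, hSg, schwartzD_add, schwartzD_smul, schwartzD_schwartzX, hsum, listD_cons,
        List.map_append, List.sum_append, smul_add, add_assoc]
      split_ifs <;> simp

/-- Induction on `k` with `g` varying: one factor `x_j` is absorbed into `g`, which stays
band-limited. The commutator has at most `n` terms of order `n - 1`; this gives one more factor `n +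
1` and the constant `C / r`. -/
lemma BandLimited.coord_pow_mul_norm_listD_le {r : ℝ} (hr : 0 < r) (j : Fin d) (k : ℕ) :
    ∀ {g : 𝓢(EuclideanSpace ℝ (Fin d), ℂ)}, BandLimited r g →
    ∃ C, 0 ≤ C ∧ ∀ (L : List (Fin d)) (x : EuclideanSpace ℝ (Fin d)),
      |x j| ^ k * ‖listD L g x‖ ≤ C * r ^ L.length * ((L.length : ℝ) + 1) ^ k := by
  induction k with
  | zero =>
    intro g hg
    refine ⟨∫ ξ, ‖𝓕 g ξ‖, integral_nonneg fun _ => norm_nonneg _, fun L x => ?_⟩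
    simpa [mul_comm] using hg.norm_listD_le L x
  | succ k ih =>
    intro g hg
    obtain ⟨C, hC, hgC⟩ := ih hg
    obtain ⟨B, hB, hgB⟩ := ih (hg.mul_coord j)
    refine ⟨B + C / r, by positivity, fun L x => ?_⟩
    obtain ⟨S, hS, hSL, hSg⟩ := exists_listD_schwartzX j L
    set n := L.length with hn
    have hsum : |x j| ^ k * ‖(S.map fun M => listD M g).sum x‖ ≤
        S.length * (C / r * r ^ n * ((n : ℝ) + 1) ^ k) := by
      clear hS hSg
      induction S with
      | nil => simp
      | cons M S ihS =>
        have h1 := ihS fun M' hM' => hSL M' (by simp [hM'])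
        have h2 : |x j| ^ k * ‖listD M g x‖ ≤ C / r * r ^ n * ((n : ℝ) + 1) ^ k := by
          refine (hgC M x).trans ?_
          rw [← hSL M (by simp), pow_succ]
          have : C / r * (r ^ M.length * r) = C * r ^ M.length := by field_simp
          rw [this]
          gcongr
          linarith
        rw [List.map_cons, List.sum_cons, add_apply, List.length_cons]
        calc _ ≤ |x j| ^ k * (‖listD M g x‖ + ‖(S.map fun M => listD M g).sum x‖) := by
              gcongr; exact norm_add_le _ _
          _ ≤ _ := by rw [mul_add]; push_cast; linarith
    have heq : (x j : ℂ) * listD L g x =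
        listD L (schwartzX j g) x + Complex.I * (S.map fun M => listD M g).sum x := by
      rw [hSg, add_apply, schwartzX_apply, smul_apply, smul_eq_mul]
      ring
    have hSn : (S.length : ℝ) ≤ (n : ℝ) + 1 := by
      have : (S.length : ℝ) ≤ n := by exact_mod_cast hS
      linarith
    calc |x j| ^ (k + 1) * ‖listD L g x‖ = |x j| ^ k * ‖(x j : ℂ) * listD L g x‖ := by
          rw [norm_mul, Complex.norm_real, Real.norm_eq_abs]; ring
      _ ≤ |x j| ^ k * (‖listD L (schwartzX j g) x‖ + ‖(S.map fun M => listD M g).sum x‖) := by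
          rw [heq]
          gcongr
          refine (norm_add_le _ _).trans (by simp)
      _ ≤ B * r ^ n * ((n : ℝ) + 1) ^ k + S.length * (C / r * r ^ n * ((n : ℝ) + 1) ^ k) := by
          rw [mul_add]
          exact add_le_add (hgB L x) hsum
      _ ≤ B * r ^ n * ((n : ℝ) + 1) ^ (k + 1) +
            ((n : ℝ) + 1) * (C / r * r ^ n * ((n : ℝ) + 1) ^ k) := by
          gcongr
          · have : (0 : ℝ) ≤ n := n.cast_nonneg
            linarith
          · omega
      _ = _ := by ring

lemma one_add_norm_pow_le {𝕜 : Type*} [RCLike 𝕜] (k : ℕ) (x : EuclideanSpace 𝕜 (Fin d)) :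
    (1 + ‖x‖) ^ k ≤ ((d : ℝ) + 1) ^ k * (1 + ∑ j, ‖x j‖ ^ k) := by
  -- Here `m` is the maximum of the `‖x j‖` if that is at least `1`, and `1` otherwise.
  have h1 : ∃ m : ℝ, 0 ≤ m ∧ (∀ j, ‖x j‖ ≤ m) ∧ m ^ k ≤ 1 + ∑ j, ‖x j‖ ^ k ∧ 1 ≤ m := by
    by_cases h : ∃ j, 1 ≤ ‖x j‖
    · obtain ⟨j, hj⟩ := h
      obtain ⟨i, -, hi⟩ := Finset.exists_max_image Finset.univ (fun j => ‖x j‖) ⟨j, Finset.mem_univ j⟩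
      refine ⟨‖x i‖, norm_nonneg _, fun j => hi j (Finset.mem_univ j), ?_,
        hj.trans (hi j (Finset.mem_univ j))⟩
      have := Finset.single_le_sum (f := fun j => ‖x j‖ ^ k) (fun j _ => by positivity)
        (Finset.mem_univ i)
      linarith
    · push Not at h
      refine ⟨1, zero_le_one, fun j => (h j).le, ?_, le_rfl⟩
      have : 0 ≤ ∑ j, ‖x j‖ ^ k := Finset.sum_nonneg fun j _ => by positivity
      simpa using this
  obtain ⟨m, hm, hxm, hmk, hm1⟩ := h1
  have h2 : ‖x‖ ≤ d * m := by
    have h3 : x = ∑ j, EuclideanSpace.single j (x j) := by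
      ext i; simp
    calc ‖x‖ = ‖∑ j, EuclideanSpace.single j (x j)‖ := by rw [← h3]
      _ ≤ ∑ j, ‖x j‖ := (norm_sum_le _ _).trans (by simp)
      _ ≤ ∑ _j : Fin d, m := Finset.sum_le_sum fun j _ => hxm j
      _ = _ := by simp
  calc (1 + ‖x‖) ^ k ≤ (((d : ℝ) + 1) * m) ^ k := by gcongr; linarith
    _ = ((d : ℝ) + 1) ^ k * m ^ k := mul_pow _ _ _
    _ ≤ _ := by gcongr

lemma BandLimited.one_add_norm_pow_mul_norm_listD_le {r : ℝ} (hr : 0 < r)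
    {g : 𝓢(EuclideanSpace ℝ (Fin d), ℂ)} (hg : BandLimited r g) (k : ℕ) :
    ∃ C, 0 ≤ C ∧ ∀ (L : List (Fin d)) (x : EuclideanSpace ℝ (Fin d)),
      (1 + ‖x‖) ^ k * ‖listD L g x‖ ≤ C * r ^ L.length * ((L.length : ℝ) + 1) ^ k := by
  choose C hC hgC using fun j => hg.coord_pow_mul_norm_listD_le hr j k
  set B := ∫ ξ, ‖𝓕 g ξ‖
  have hB : 0 ≤ B := integral_nonneg fun _ => norm_nonneg _
  have hsum : 0 ≤ ∑ j, C j := Finset.sum_nonneg fun j _ => hC j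
  refine ⟨((d : ℝ) + 1) ^ k * (B + ∑ j, C j), by positivity, fun L x => ?_⟩
  have h1 : ‖listD L g x‖ ≤ B * r ^ L.length * ((L.length : ℝ) + 1) ^ k := by
    refine (hg.norm_listD_le L x).trans ?_
    rw [mul_comm]
    exact le_mul_of_one_le_right (by positivity) (one_le_pow₀ (by simp))
  calc (1 + ‖x‖) ^ k * ‖listD L g x‖
      ≤ ((d : ℝ) + 1) ^ k * (1 + ∑ j, ‖x j‖ ^ k) * ‖listD L g x‖ := by
        gcongr; exact one_add_norm_pow_le k x
    _ = ((d : ℝ) + 1) ^ k * (‖listD L g x‖ + ∑ j, |x j| ^ k * ‖listD L g x‖) := by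
        rw [← Finset.sum_mul]; simp only [Real.norm_eq_abs]; ring
    _ ≤ ((d : ℝ) + 1) ^ k * (B * r ^ L.length * ((L.length : ℝ) + 1) ^ k +
          ∑ j, C j * r ^ L.length * ((L.length : ℝ) + 1) ^ k) := by
        exact mul_le_mul_of_nonneg_left
          (add_le_add h1 (Finset.sum_le_sum fun j _ => hgC j L x)) (by positivity)
    _ = _ := by rw [← Finset.sum_mul, ← Finset.sum_mul]; ring

/-- With `ρ = (n + 1) / (1 + ‖x‖)`, the integer exponents `0` and `⌈l⌉` suffice: `ρ ^ ⌈l⌉ ≤ ρ ^ l`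
if `ρ ≤ 1`, and `1 ≤ ρ ^ l` if `ρ ≥ 1`. -/
lemma BandLimited.norm_listD_le_rpow {r : ℝ} (hr : 0 < r)
    {g : 𝓢(EuclideanSpace ℝ (Fin d), ℂ)} (hg : BandLimited r g) {l : ℝ} (hl : 0 ≤ l) :
    ∃ C, 0 < C ∧ ∀ (L : List (Fin d)) (x : EuclideanSpace ℝ (Fin d)),
      ‖listD L g x‖ ≤ C * r ^ L.length * ((L.length : ℝ) + 1) ^ l * (1 + ‖x‖) ^ (-l) := by
  obtain ⟨C, hC, hgC⟩ := hg.one_add_norm_pow_mul_norm_listD_le hr 0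
  obtain ⟨B, hB, hgB⟩ := hg.one_add_norm_pow_mul_norm_listD_le hr ⌈l⌉₊
  refine ⟨B + C + 1, by positivity, fun L x => ?_⟩
  set n := L.length
  have hx : 0 < 1 + ‖x‖ := by positivity
  have hn : (0 : ℝ) < n + 1 := by positivity
  have hq : 0 < ((n : ℝ) + 1) / (1 + ‖x‖) := by positivity
  have hrw : ((n : ℝ) + 1) ^ l * (1 + ‖x‖) ^ (-l) = (((n : ℝ) + 1) / (1 + ‖x‖)) ^ l := by
    rw [Real.rpow_neg hx.le, Real.div_rpow hn.le hx.le, div_eq_mul_inv]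
  rw [mul_assoc, hrw]
  rcases le_total ((n : ℝ) + 1) (1 + ‖x‖) with h | h
  · have h1 : ‖listD L g x‖ ≤ B * r ^ n * (((n : ℝ) + 1) / (1 + ‖x‖)) ^ ⌈l⌉₊ := by
      rw [div_pow, mul_div_assoc', le_div_iff₀ (by positivity), mul_comm]
      exact hgB L x
    refine h1.trans ?_
    have h2 : (((n : ℝ) + 1) / (1 + ‖x‖)) ^ ⌈l⌉₊ ≤ (((n : ℝ) + 1) / (1 + ‖x‖)) ^ l := by
      rw [← Real.rpow_natCast]
      exact Real.rpow_le_rpow_of_exponent_ge hq ((div_le_one hx).2 h) (Nat.le_ceil l)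
    gcongr
    linarith
  · have h1 : ‖listD L g x‖ ≤ C * r ^ n := by simpa using hgC L x
    refine h1.trans ?_
    have h2 : 1 ≤ (((n : ℝ) + 1) / (1 + ‖x‖)) ^ l :=
      Real.one_le_rpow ((one_le_div hx).2 h) hl
    refine le_trans ?_ (le_mul_of_one_le_right (by positivity) h2)
    gcongr
    linarith

/-! ### Angular frequencies, and band limitation from derivative bounds -/

lemma fourierHat_eq (f : EuclideanSpace ℝ (Fin d) → ℂ) (ξ : EuclideanSpace ℝ (Fin d)) :
    fourierHat f ξ = 𝓕 f ((2 * Real.pi)⁻¹ • ξ) := by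
  rw [fourierHat, Real.fourier_eq']
  refine integral_congr_ae (.of_forall fun x => ?_)
  simp only [smul_eq_mul, inner_smul_right]
  rw [mul_comm]
  congr 2
  have : (Real.pi : ℂ) ≠ 0 := by exact_mod_cast Real.pi_ne_zero
  push_cast
  field_simp

lemma supNorm_le_iff {x : EuclideanSpace ℝ (Fin d)} {r : ℝ} (hr : 0 ≤ r) :
    supNorm x ≤ r ↔ ∀ j, |x j| ≤ r := by
  simp [supNorm, pi_norm_le_iff_of_nonneg hr]

lemma continuous_supNorm : Continuous (supNorm : EuclideanSpace ℝ (Fin d) → ℝ) := by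
  unfold supNorm; fun_prop

lemma isClosed_cube (r : ℝ) : IsClosed (cube d r) :=
  isClosed_le continuous_supNorm continuous_const

lemma bandLimited_iff {g : 𝓢(EuclideanSpace ℝ (Fin d), ℂ)} {r : ℝ} (hr : 0 ≤ r) :
    BandLimited r g ↔ tsupport (fourierHat g) ⊆ cube d r := by
  constructor
  · intro hg
    refine closure_minimal (fun ξ hξ => ?_) (isClosed_cube r)
    rw [Function.mem_support, fourierHat_eq] at hξ
    refine (supNorm_le_iff hr).2 fun j => ?_
    have := hg _ hξ j
    rwa [PiLp.smul_apply, smul_eq_mul, mul_inv_cancel_left₀ (by positivity)] at this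
  · intro h ξ hξ j
    have h1 : fourierHat g ((2 * Real.pi) • ξ) ≠ 0 := by
      rwa [fourierHat_eq, smul_smul, inv_mul_cancel₀ (by positivity), one_smul]
    have h2 := (supNorm_le_iff hr).1 (h (subset_tsupport _ h1)) j
    simpa using h2

lemma multiLength_single (j : Fin d) (n : ℕ) : multiLength (Pi.single j n) = n := by
  simp [multiLength]

lemma fourier_listD_single (g : 𝓢(EuclideanSpace ℝ (Fin d), ℂ)) (j : Fin d) (n : ℕ)
    (ξ : EuclideanSpace ℝ (Fin d)) :
    𝓕 (listD (multiList (Pi.single j n)) g) ξ = ((2 * Real.pi * ξ j : ℝ) : ℂ) ^ n * 𝓕 g ξ := by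
  rw [fourier_listD, prod_multiList, Finset.prod_eq_single j]
  · simp
  · intro i _ hi; simp [hi]
  · simp

lemma integrable_one_add_norm_rpow :
    Integrable fun x : EuclideanSpace ℝ (Fin d) => (1 + ‖x‖) ^ (-((d : ℝ) + 1)) :=
  integrable_one_add_norm (by simp)

lemma norm_fourier_le_of_norm_le (f : EuclideanSpace ℝ (Fin d) → ℂ) {A : ℝ}
    (hA : ∀ x, ‖f x‖ ≤ A * (1 + ‖x‖) ^ (-((d : ℝ) + 1))) (ξ : EuclideanSpace ℝ (Fin d)) :
    ‖𝓕 f ξ‖ ≤ A * ∫ x : EuclideanSpace ℝ (Fin d), (1 + ‖x‖) ^ (-((d : ℝ) + 1)) := by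
  rw [Real.fourier_eq, ← integral_const_mul]
  refine norm_integral_le_of_norm_le (integrable_one_add_norm_rpow.const_mul _)
    (.of_forall fun x => ?_)
  rw [Circle.norm_smul]
  exact hA x

lemma eq_zero_of_forall_pow_mul_le {q a C : ℝ} (hq : 1 < q) (k : ℕ) (ha : 0 ≤ a)
    (h : ∀ n : ℕ, q ^ n * a ≤ C * ((n : ℝ) + 1) ^ k) : a = 0 := by
  refine le_antisymm ?_ ha
  -- The limit is taken along `n + 1`, to match `(n + 1) ^ k`; the constant `C * q` compensates for
  -- the extra factor `q` in the denominator.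
  have h1 := ((tendsto_pow_const_div_const_pow_of_one_lt k hq).comp (tendsto_add_atTop_nat 1)).const_mul
    (C * q)
  rw [mul_zero] at h1
  refine ge_of_tendsto' h1 fun n => ?_
  have hq0 : 0 < q := by linarith
  simp only [Function.comp_apply]
  push_cast
  rw [pow_succ, ← mul_div_assoc, le_div_iff₀ (by positivity)]
  nlinarith [h n]

/-- Only the pure powers `D_j^n` are needed. The decay exponent `d + 1` makes the bound integrable,
so it passes to the Fourier transform; an exponential rate above `1` cannot be polynomially bounded.
-/
lemma bandLimited_of_norm_multiD_le {R : ℝ} (hR : 0 < R) {g : 𝓢(EuclideanSpace ℝ (Fin d), ℂ)}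
    (h : ∃ C : ℝ, ∀ (x : EuclideanSpace ℝ (Fin d)) (α : Fin d → ℕ),
      ‖multiD α g x‖ ≤ C * R ^ multiLength α * ((multiLength α : ℝ) + 1) ^ ((d : ℝ) + 1) *
        (1 + ‖x‖) ^ (-((d : ℝ) + 1))) : BandLimited R g := by
  obtain ⟨C, hC⟩ := h
  intro ξ hξ j
  by_contra! hj
  set I := ∫ x : EuclideanSpace ℝ (Fin d), (1 + ‖x‖) ^ (-((d : ℝ) + 1))
  refine hξ (norm_eq_zero.1 (eq_zero_of_forall_pow_mul_le (q := |2 * Real.pi * ξ j| / R)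
    (C := C * I) ((one_lt_div hR).2 hj) (d + 1) (norm_nonneg _) fun n => ?_))
  have h1 := norm_fourier_le_of_norm_le (multiD (Pi.single j n) g) (fun x => hC x (Pi.single j n)) ξ
  rw [multiD_eq_listD, ← SchwartzMap.fourier_coe, fourier_listD_single, multiLength_single, norm_mul,
    norm_pow, Complex.norm_real, Real.norm_eq_abs] at h1
  rw [div_pow, div_mul_eq_mul_div, div_le_iff₀ (by positivity)]
  refine h1.trans_eq ?_
  rw [← Real.rpow_natCast _ (d + 1)]
  push_cast
  ring

/-! ### Limits of `n`-th roots and the growth of derivatives in `L^p` -/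

lemma tendsto_ofReal_mul_pow_rpow_inv {c t : ℝ} (hc : 0 < c) (ht : 0 < t) (m : ℝ) :
    Tendsto (fun n : ℕ => ENNReal.ofReal (c * ((n : ℝ) + 1) ^ m * t ^ n) ^ (1 / (n : ℝ))) atTop
      (𝓝 (ENNReal.ofReal t)) := by
  have h0 : Tendsto (fun n : ℕ => c ^ (1 / (n : ℝ))) atTop (𝓝 1) := by
    simpa using (tendsto_const_nhds (x := c)).rpow tendsto_one_div_atTop_nhds_zero_nat
      (Or.inl hc.ne')
  have h1 : Tendsto (fun n : ℕ => ((n : ℝ) + 1) ^ (m / (n : ℝ))) atTop (𝓝 1) := by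
    -- At the argument `n + 1`, the coefficients `1` and `-1` turn the exponent into `m / n`.
    have := ((tendsto_rpow_div_mul_add m 1 (-1) (by norm_num)).comp
      (tendsto_atTop_add_const_right _ (1 : ℝ) tendsto_id)).comp tendsto_natCast_atTop_atTop
    refine this.congr fun n => ?_
    simp
  have h2 := (ENNReal.tendsto_ofReal ((h0.mul h1).mul_const t))
  rw [one_mul, one_mul] at h2
  refine h2.congr' ?_
  filter_upwards [eventually_gt_atTop 0] with n hn
  have hn' : (n : ℝ) ≠ 0 := by positivity
  rw [ENNReal.ofReal_rpow_of_nonneg (by positivity) (by positivity),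
    Real.mul_rpow (by positivity) (by positivity), Real.mul_rpow (by positivity) (by positivity),
    ← Real.rpow_mul (by positivity), ← Real.rpow_natCast t, ← Real.rpow_mul ht.le,
    mul_one_div, mul_one_div, div_self hn', Real.rpow_one]

lemma tendsto_rpow_inv_of_bounds {u : ℕ → ℝ≥0∞} {r : ℝ} (hr : 0 < r)
    (hup : ∃ C : ℝ, 0 < C ∧ ∃ m : ℝ, ∀ n : ℕ,
      u n ≤ ENNReal.ofReal (C * ((n : ℝ) + 1) ^ m * r ^ n))
    (hlow : ∀ t : ℝ, 0 < t → t < r → ∃ c : ℝ, 0 < c ∧ ∃ m : ℝ, ∀ n : ℕ,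
      ENNReal.ofReal (c * ((n : ℝ) + 1) ^ m * t ^ n) ≤ u n) :
    Tendsto (fun n : ℕ => u n ^ (1 / (n : ℝ))) atTop (𝓝 (ENNReal.ofReal r)) := by
  have hmono {a b : ℝ≥0∞} (n : ℕ) (h : a ≤ b) : a ^ (1 / (n : ℝ)) ≤ b ^ (1 / (n : ℝ)) :=
    ENNReal.rpow_le_rpow h (by positivity)
  refine tendsto_of_le_liminf_of_limsup_le ?_ ?_
  · refine le_of_forall_lt fun a ha => ?_
    obtain ⟨b, hab, hbr⟩ := exists_between ha
    have hb : b ≠ ∞ := ne_top_of_lt hbr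
    have hb0 : 0 < b.toReal := ENNReal.toReal_pos (ne_bot_of_gt hab) hb
    obtain ⟨c, hc, m, hm⟩ := hlow b.toReal hb0 (ENNReal.toReal_lt_of_lt_ofReal hbr)
    refine hab.trans_le ?_
    have := (tendsto_ofReal_mul_pow_rpow_inv hc hb0 m).liminf_eq
    rw [ENNReal.ofReal_toReal hb] at this
    rw [← this]
    exact liminf_le_liminf (.of_forall fun n => hmono n (hm n))
  · obtain ⟨C, hC, m, hm⟩ := hup
    rw [← (tendsto_ofReal_mul_pow_rpow_inv hC hr m).limsup_eq]
    exact limsup_le_limsup (.of_forall fun n => hmono n (hm n))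

lemma exists_eLpNorm_one_add_norm_lt_top (p : ℝ≥0∞) :
    ∃ k : ℕ, eLpNorm (fun x : EuclideanSpace ℝ (Fin d) => (1 + ‖x‖) ^ (-(k : ℝ))) p volume < ∞ :=
  Measure.HasTemperateGrowth.exists_eLpNorm_lt_top p inferInstance

lemma BandLimited.exists_eLpNorm_listD_le {r : ℝ} (hr : 0 < r)
    {g : 𝓢(EuclideanSpace ℝ (Fin d), ℂ)} (hg : BandLimited r g) (p : ℝ≥0∞) :
    ∃ C : ℝ, 0 < C ∧ ∃ m : ℝ, ∀ L : List (Fin d), eLpNorm (listD L g) p volume ≤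
      ENNReal.ofReal (C * ((L.length : ℝ) + 1) ^ m * r ^ L.length) := by
  obtain ⟨k, hk⟩ := exists_eLpNorm_one_add_norm_lt_top (d := d) p
  obtain ⟨C, hC, hgC⟩ := hg.norm_listD_le_rpow hr k.cast_nonneg
  set K := eLpNorm (fun x : EuclideanSpace ℝ (Fin d) => (1 + ‖x‖) ^ (-(k : ℝ))) p volume
  refine ⟨C * (K.toReal + 1), by positivity, k, fun L => ?_⟩
  have h1 := eLpNorm_le_mul_eLpNorm_of_ae_le_mul (μ := volume)
    (f := listD L g) (g := fun x : EuclideanSpace ℝ (Fin d) => (1 + ‖x‖) ^ (-(k : ℝ)))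
    (c := C * r ^ L.length * ((L.length : ℝ) + 1) ^ (k : ℝ)) (.of_forall fun x => by
      rw [Real.norm_of_nonneg (by positivity : 0 ≤ (1 + ‖x‖) ^ (-(k : ℝ)))]
      exact hgC L x) p
  refine h1.trans ?_
  calc _ = ENNReal.ofReal (C * r ^ L.length * ((L.length : ℝ) + 1) ^ (k : ℝ)) *
        ENNReal.ofReal K.toReal := by rw [ENNReal.ofReal_toReal hk.ne]
    _ ≤ _ := by
        rw [← ENNReal.ofReal_mul (by positivity)]
        refine ENNReal.ofReal_le_ofReal ?_
        have : 0 ≤ C * r ^ L.length * ((L.length : ℝ) + 1) ^ (k : ℝ) := by positivity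
        nlinarith

/-- Plancherel, restricted to the open set where the `j`-th angular frequency exceeds `t` in
absolute value. There `𝓕 g` has positive `L²` mass, which serves as `c`. -/
lemma exists_le_integral_norm_sq_listD (g : 𝓢(EuclideanSpace ℝ (Fin d), ℂ)) {t : ℝ} (ht : 0 < t)
    {ξ : EuclideanSpace ℝ (Fin d)} {j : Fin d} (hξ : 𝓕 g ξ ≠ 0) (hj : t < |2 * Real.pi * ξ j|) :
    ∃ c : ℝ, 0 < c ∧ ∀ n : ℕ,
      c * (t ^ 2) ^ n ≤ ∫ x, ‖listD (multiList (Pi.single j n)) g x‖ ^ 2 := by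
  set U := {ξ : EuclideanSpace ℝ (Fin d) | t < |2 * Real.pi * ξ j|} with hUdef
  have hU : IsOpen U := isOpen_lt continuous_const (by fun_prop)
  have hint (h : 𝓢(EuclideanSpace ℝ (Fin d), ℂ)) : Integrable fun x => ‖h x‖ ^ 2 := by
    simpa using (h.memLp 2).integrable_norm_pow (by norm_num)
  refine ⟨∫ η in U, ‖𝓕 g η‖ ^ 2, ?_, fun n => ?_⟩
  · rw [setIntegral_pos_iff_support_of_nonneg_ae (.of_forall fun _ => by positivity)
      (hint _).integrableOn]
    have hV : IsOpen ((Function.support fun η => ‖𝓕 g η‖ ^ 2) ∩ U) := by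
      refine IsOpen.inter (Continuous.isOpen_support ?_) hU
      exact ((𝓕 g).continuous.norm).pow 2
    exact hV.measure_pos _ ⟨ξ, by simpa using hξ, hj⟩
  · rw [← SchwartzMap.integral_norm_sq_fourier, mul_comm, ← integral_const_mul]
    refine le_trans (setIntegral_mono_on ((hint _).integrableOn.const_mul _)
      (hint (𝓕 (listD (multiList (Pi.single j n)) g))).integrableOn hU.measurableSet fun η hη => ?_)
      (setIntegral_le_integral (hint _) (.of_forall fun _ => by positivity))
    rw [fourier_listD_single, norm_mul, mul_pow, norm_pow, Complex.norm_real, Real.norm_eq_abs,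
      ← pow_mul, ← pow_mul, mul_comm n 2]
    gcongr
    exact le_of_lt hη

lemma ofReal_integral_norm_sq_le (g : 𝓢(EuclideanSpace ℝ (Fin d), ℂ)) (p q : ℝ≥0∞)
    [ENNReal.HolderConjugate p q] :
    ENNReal.ofReal (∫ x, ‖g x‖ ^ 2) ≤ eLpNorm g p volume * eLpNorm g q volume := by
  have hg : AEStronglyMeasurable g volume := g.continuous.aestronglyMeasurable
  have h := eLpNorm_smul_le_mul_eLpNorm (p := p) (q := q) (r := 1) hg hg
  refine le_trans (le_of_eq ?_) h
  rw [eLpNorm_one_eq_lintegral_enorm, ← ofReal_integral_norm_eq_lintegral_enorm]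
  · congr 2
    ext x
    simp [sq]
  · have := (g.memLp 2).integrable_mul (g.memLp 2)
    exact this

lemma BandLimited.tendsto_maxDerivNorm {r : ℝ} (hr : 0 < r) {p : ℝ≥0∞} (hp : 1 ≤ p)
    {g : 𝓢(EuclideanSpace ℝ (Fin d), ℂ)} (hg : BandLimited r g)
    (hex : ∀ t, 0 < t → t < r → ∃ ξ j, 𝓕 g ξ ≠ 0 ∧ t < |2 * Real.pi * ξ j|) :
    Tendsto (fun n : ℕ => maxDerivNorm p g n ^ (1 / (n : ℝ))) atTop (𝓝 (ENNReal.ofReal r)) := by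
  refine tendsto_rpow_inv_of_bounds hr ?_ fun t ht htr => ?_
  · obtain ⟨C, hC, m, hm⟩ := hg.exists_eLpNorm_listD_le hr p
    refine ⟨C, hC, m, fun n => iSup₂_le fun α hα => ?_⟩
    rw [multiD_eq_listD, ← hα, ← length_multiList]
    exact hm _
  · have hs : Real.sqrt (t * r) < r := by
      rw [Real.sqrt_lt' hr]; nlinarith
    have hs0 : 0 < Real.sqrt (t * r) := Real.sqrt_pos.2 (by positivity)
    obtain ⟨ξ, j, hξ, hj⟩ := hex _ hs0 hs
    obtain ⟨c, hc, hcn⟩ := exists_le_integral_norm_sq_listD g hs0 hξ hj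
    rw [Real.sq_sqrt (by positivity)] at hcn
    obtain ⟨C, hC, m, hm⟩ := hg.exists_eLpNorm_listD_le hr p.conjExponent
    have hpq : ENNReal.HolderConjugate p p.conjExponent := ENNReal.HolderConjugate.conjExponent hp
    refine ⟨c / C, by positivity, -m, fun n => ?_⟩
    have h1 : ENNReal.ofReal (c * (t * r) ^ n) ≤
        maxDerivNorm p g n * ENNReal.ofReal (C * ((n : ℝ) + 1) ^ m * r ^ n) := by
      refine (ENNReal.ofReal_le_ofReal (hcn n)).trans
        ((ofReal_integral_norm_sq_le _ p p.conjExponent).trans (mul_le_mul' ?_ ?_))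
      · rw [← multiD_eq_listD]
        exact le_iSup₂_of_le (Pi.single j n) (multiLength_single j n) le_rfl
      · simpa [length_multiList, multiLength_single] using hm (multiList (Pi.single j n))
    have hpos : 0 < C * ((n : ℝ) + 1) ^ m * r ^ n := by positivity
    refine le_trans (le_of_eq ?_) (ENNReal.div_le_of_le_mul h1)
    rw [← ENNReal.ofReal_div_of_pos hpos, Real.rpow_neg (by positivity), mul_pow]
    congr 1
    have : ((n : ℝ) + 1) ^ m ≠ 0 := by positivity
    field_simp

lemma exists_radius (hd : 0 < d) (g : 𝓢(EuclideanSpace ℝ (Fin d), ℂ))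
    (h : supportRadius (fourierHat g) ≠ ∞) :
    g = 0 ∨ ∃ r, 0 < r ∧ supportRadius (fourierHat g) = ENNReal.ofReal r ∧ BandLimited r g ∧
      ∀ t, 0 < t → t < r → ∃ ξ j, 𝓕 g ξ ≠ 0 ∧ t < |2 * Real.pi * ξ j| := by
  set r := (supportRadius (fourierHat g)).toReal with hrdef
  have hr : supportRadius (fourierHat g) = ENNReal.ofReal r := (ENNReal.ofReal_toReal h).symm
  have hr0 : 0 ≤ r := ENNReal.toReal_nonneg
  have hband : BandLimited r g := by
    rw [bandLimited_iff hr0]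
    intro ξ hξ
    have h1 : ENNReal.ofReal (supNorm ξ) ≤ supportRadius (fourierHat g) :=
      le_iSup₂_of_le ξ hξ le_rfl
    rwa [hr, ENNReal.ofReal_le_ofReal_iff hr0] at h1
  rcases hr0.eq_or_lt with h0 | h0
  · left
    rw [← h0] at hband
    have : Nonempty (Fin d) := ⟨⟨0, hd⟩⟩
    -- Radius zero confines the support of `𝓕 g` to the origin. As `d > 0`, the complement of the
    -- origin is dense, and continuity gives `𝓕 g = 0`.
    have hz : Set.EqOn (𝓕 g : 𝓢(EuclideanSpace ℝ (Fin d), ℂ)) 0 {0}ᶜ := by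
      intro ξ hξ
      by_contra hne
      refine hξ ?_
      ext j
      have := abs_nonpos_iff.1 (hband ξ hne j)
      simpa [Real.pi_ne_zero] using this
    have hF : 𝓕 g = 0 := by
      ext ξ
      exact congrFun (Continuous.ext_on (dense_compl_singleton 0) (𝓕 g).continuous
        continuous_zero hz) ξ
    rw [← FourierTransform.fourierInv_fourier_eq g (F := 𝓢(EuclideanSpace ℝ (Fin d), ℂ)), hF,
      FourierTransform.fourierInv_zero]
  · refine Or.inr ⟨r, h0, hr, hband, fun t ht htr => ?_⟩
    have h1 : ENNReal.ofReal t < supportRadius (fourierHat g) := by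
      rw [hr]; exact (ENNReal.ofReal_lt_ofReal_iff h0).2 htr
    obtain ⟨η, hη⟩ := lt_iSup_iff.1 h1
    obtain ⟨hη1, hη2⟩ := lt_iSup_iff.1 hη
    rw [ENNReal.ofReal_lt_ofReal_iff_of_nonneg ht.le] at hη2
    obtain ⟨ζ, hζ1, hζ2⟩ := mem_closure_iff.1 hη1 _
      (isOpen_lt continuous_const (continuous_supNorm (d := d))) hη2
    rw [Function.mem_support, fourierHat_eq] at hζ2
    have h2 : ¬ ∀ j, |ζ j| ≤ t := fun h => not_lt.2 ((supNorm_le_iff ht.le).2 h) hζ1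
    push Not at h2
    obtain ⟨j, hj⟩ := h2
    refine ⟨_, j, hζ2, ?_⟩
    rwa [PiLp.smul_apply, smul_eq_mul, mul_inv_cancel_left₀ (by positivity)]

lemma maxDerivNorm_zero (p : ℝ≥0∞) (n : ℕ) :
    maxDerivNorm p (0 : 𝓢(EuclideanSpace ℝ (Fin d), ℂ)) n = 0 := by
  have h (L : List (Fin d)) : listD L (0 : 𝓢(EuclideanSpace ℝ (Fin d), ℂ)) = 0 := by
    induction L with
    | nil => rfl
    | cons j L ih => rw [listD_cons, ih, schwartzD, LineDeriv.lineDerivOp_zero, smul_zero]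
  have h0 : ((0 : 𝓢(EuclideanSpace ℝ (Fin d), ℂ)) : EuclideanSpace ℝ (Fin d) → ℂ) = 0 := by
    ext; simp
  rw [maxDerivNorm]
  simp_rw [multiD_eq_listD, h, h0]
  simp

/-! ### The Wigner transform -/

lemma conj_eq_integral_fourier (g : 𝓢(EuclideanSpace ℝ (Fin d), ℂ))
    (v : EuclideanSpace ℝ (Fin d)) :
    (starRingEnd ℂ) (g v) = ∫ η, (starRingEnd ℂ) (𝓕 g η) *
      Complex.exp (-(2 * Real.pi * Complex.I) * ((inner ℝ η v : ℝ) : ℂ)) := by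
  have h1 : g v = 𝓕⁻ (𝓕 g : 𝓢(EuclideanSpace ℝ (Fin d), ℂ)) v := by
    rw [FourierTransform.fourierInv_fourier_eq]
  rw [h1, SchwartzMap.fourierInv_coe, Real.fourierInv_eq', ← integral_conj]
  refine integral_congr_ae (.of_forall fun η => ?_)
  simp only [smul_eq_mul, map_mul, ← Complex.exp_conj, Complex.conj_ofReal, Complex.conj_I]
  rw [mul_comm]
  congr 2
  push_cast
  ring

/-- The function of `ζ` whose inverse Fourier transform at `2x` is, up to a phase and a constant,
the Wigner transform of `g` at `(x, ξ)`. -/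
def wignerKernel (g : 𝓢(EuclideanSpace ℝ (Fin d), ℂ)) (ξ ζ : EuclideanSpace ℝ (Fin d)) : ℂ :=
  𝓕 g ζ * (starRingEnd ℂ) (𝓕 g (Real.pi⁻¹ • ξ - ζ))

lemma fourier_conj_comp_sub (g : 𝓢(EuclideanSpace ℝ (Fin d), ℂ))
    (x ξ u : EuclideanSpace ℝ (Fin d)) :
    𝓕 (fun ζ => (starRingEnd ℂ) (𝓕 g (Real.pi⁻¹ • ξ - ζ)) *
      Complex.exp (Complex.I * ((4 * Real.pi * inner ℝ x ζ - 2 * inner ℝ x ξ : ℝ) : ℂ))) u =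
    (starRingEnd ℂ) (g ((2 : ℝ) • x - u)) *
      Complex.exp (-Complex.I * ((2 * inner ℝ ξ (u - x) : ℝ) : ℂ)) := by
  -- The substitution is `η = ξ/π - ζ`.
  rw [Real.fourier_eq', ← integral_sub_left_eq_self _ volume (Real.pi⁻¹ • ξ),
    conj_eq_integral_fourier, ← integral_mul_const]
  refine integral_congr_ae (.of_forall fun η => ?_)
  simp only [smul_eq_mul, sub_sub_cancel]
  rw [mul_left_comm, ← Complex.exp_add, mul_assoc ((starRingEnd ℂ) _), ← Complex.exp_add]
  congr 2
  simp only [inner_sub_left, inner_sub_right, inner_smul_left, inner_smul_right, conj_trivial]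
  rw [real_inner_comm ξ x, real_inner_comm η x]
  have : (Real.pi : ℂ) ≠ 0 := by exact_mod_cast Real.pi_ne_zero
  push_cast
  field_simp
  ring

/-- The variable `u = x + t/2` turns the integral into `2^d ∫ g · 𝓕 k`, where `𝓕 k` carries the
conjugated factor and the phase. The exchange formula `∫ g · 𝓕 k = ∫ 𝓕 g · k` then moves everything
to the frequency side. -/
lemma wigner_eq (g : 𝓢(EuclideanSpace ℝ (Fin d), ℂ)) (x ξ : EuclideanSpace ℝ (Fin d)) :
    wigner g x ξ = 2 ^ d * Complex.exp (-Complex.I * ((2 * inner ℝ x ξ : ℝ) : ℂ)) *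
      𝓕⁻ (wignerKernel g ξ) ((2 : ℝ) • x) := by
  set k : EuclideanSpace ℝ (Fin d) → ℂ := fun ζ => (starRingEnd ℂ) (𝓕 g (Real.pi⁻¹ • ξ - ζ)) *
      Complex.exp (Complex.I * ((4 * Real.pi * inner ℝ x ζ - 2 * inner ℝ x ξ : ℝ) : ℂ)) with hk
  have hkint : Integrable k := by
    have h1 : Integrable fun ζ => 𝓕 g (Real.pi⁻¹ • ξ - ζ) := (𝓕 g).integrable.comp_sub_left _
    refine h1.mono ?_ (.of_forall fun ζ => ?_)
    · refine Continuous.aestronglyMeasurable ?_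
      have := (𝓕 g).continuous
      fun_prop
    · rw [hk]
      simp only [norm_mul, RCLike.norm_conj]
      rw [mul_comm Complex.I, Complex.norm_exp_ofReal_mul_I, mul_one]
  have h1 : wigner g x ξ = ∫ t : EuclideanSpace ℝ (Fin d),
      (fun u => g (x + u) * 𝓕 k (x + u)) ((1 / 2 : ℝ) • t) := by
    rw [wigner]
    refine integral_congr_ae (.of_forall fun t => ?_)
    simp only
    rw [hk, fourier_conj_comp_sub, mul_assoc]
    congr 3
    · rw [show (2 : ℝ) • x - (x + (1 / 2 : ℝ) • t) = x - (1 / 2 : ℝ) • t by module]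
    · simp [inner_smul_right]
  have h2 : ∫ u, g u * 𝓕 k u = ∫ ζ, 𝓕 g ζ * k ζ := by
    simpa using! (VectorFourier.integral_fourierIntegral_smul_eq_flip (L := innerₗ _)
      Real.continuous_fourierChar continuous_inner g.integrable hkint).symm
  rw [h1, Measure.integral_comp_smul volume (fun u => g (x + u) * 𝓕 k (x + u)),
    integral_add_left_eq_self (fun u => g u * 𝓕 k u), h2,
    Real.fourierInv_eq', mul_assoc, ← integral_const_mul]
  have h3 : |((1 / 2 : ℝ) ^ Module.finrank ℝ (EuclideanSpace ℝ (Fin d)))⁻¹| = 2 ^ d := by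
    simp
  rw [h3, Complex.real_smul]
  push_cast
  congr 1
  refine integral_congr_ae (.of_forall fun ζ => ?_)
  simp only [hk, wignerKernel, smul_eq_mul]
  rw [← mul_assoc, ← mul_assoc (Complex.exp _), ← Complex.exp_add, mul_comm]
  congr 2
  simp only [inner_smul_right]
  rw [real_inner_comm]
  push_cast
  ring

/-- If the kernel is nonzero at `ζ`, then `ξ` is the midpoint of `2πζ` and `2ξ - 2πζ`, both of which
lie in the cube. -/
lemma BandLimited.supNorm_le_of_wigner_ne_zero {r : ℝ} (hr : 0 ≤ r)
    {g : 𝓢(EuclideanSpace ℝ (Fin d), ℂ)} (hg : BandLimited r g)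
    {x ξ : EuclideanSpace ℝ (Fin d)} (h : wigner g x ξ ≠ 0) : supNorm ξ ≤ r := by
  have h1 : ∃ ζ, wignerKernel g ξ ζ ≠ 0 := by
    by_contra! h1
    refine h ?_
    rw [wigner_eq, Real.fourierInv_eq']
    simp [h1]
  obtain ⟨ζ, hζ⟩ := h1
  obtain ⟨h1, h2⟩ := mul_ne_zero_iff.1 hζ
  rw [map_ne_zero] at h2
  refine (supNorm_le_iff hr).2 fun j => ?_
  have h3 := abs_le.1 (hg _ h1 j)
  have h4 := hg _ h2 j
  have h5 : 2 * Real.pi * (Real.pi⁻¹ • ξ - ζ) j = 2 * ξ j - 2 * Real.pi * ζ j := by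
    simp only [PiLp.sub_apply, PiLp.smul_apply, smul_eq_mul]
    field_simp
  rw [h5] at h4
  have h4 := abs_le.1 h4
  exact abs_le.2 ⟨by linarith, by linarith⟩

/-- At `ξ = 2πζ` the kernel takes the value `|𝓕 g ζ|²` at `ζ`. Were the Wigner transform zero for
all `x`, Fourier inversion would make this continuous integrable kernel vanish. -/
lemma exists_wigner_ne_zero (g : 𝓢(EuclideanSpace ℝ (Fin d), ℂ)) {ζ : EuclideanSpace ℝ (Fin d)}
    (hζ : 𝓕 g ζ ≠ 0) : ∃ x, wigner g x ((2 * Real.pi) • ζ) ≠ 0 := by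
  by_contra! h
  set φ := wignerKernel g ((2 * Real.pi) • ζ) with hφ
  have hsm : Real.pi⁻¹ • (2 * Real.pi) • ζ = (2 : ℝ) • ζ := by
    rw [smul_smul]; congr 1; field_simp
  have hcont : Continuous φ := by
    have := (𝓕 g).continuous
    unfold φ wignerKernel
    fun_prop
  have hinv : 𝓕⁻ φ = 0 := by
    ext y
    have h1 := h ((1 / 2 : ℝ) • y)
    rw [wigner_eq, smul_smul] at h1
    norm_num at h1
    simpa [Complex.exp_ne_zero] using h1
  have hint : Integrable φ := by
    have h1 : Integrable fun η => 𝓕 g η * SchwartzMap.seminorm ℝ 0 0 (𝓕 g) :=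
      (𝓕 g).integrable.mul_const _
    refine h1.mono hcont.aestronglyMeasurable (.of_forall fun η => ?_)
    simp only [hφ, wignerKernel, norm_mul, RCLike.norm_conj]
    gcongr
    refine (SchwartzMap.norm_le_seminorm ℝ (𝓕 g) _).trans ?_
    simp [abs_of_nonneg (apply_nonneg _ _)]
  have hF : 𝓕 φ = 0 := by
    ext y
    have := congrFun hinv (-y)
    rw [Real.fourierInv_eq_fourier_neg, neg_neg] at this
    exact this
  have h0 : φ = 0 := by
    have h1 := hcont.fourier_fourierInv_eq hint (by rw [hF]; exact integrable_zero _ _ _)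
    rw [← h1, hinv]
    ext y
    rw [Real.fourier_eq']
    simp
  have h1 := congrFun h0 ζ
  simp only [hφ, wignerKernel, hsm, two_smul, add_sub_cancel_right, Pi.zero_apply] at h1
  simp [hζ] at h1

/-- With `a = x + t/2` and `b = x - t/2`, both `1 + ‖x‖` and `1 + ‖t‖` are at most `(1 + ‖a‖)(1 +
‖b‖)`; decay of order `2m` in `a` and `b` therefore pays for both weights. -/
lemma exists_norm_mul_norm_le (g : 𝓢(EuclideanSpace ℝ (Fin d), ℂ)) (m : ℕ) :
    ∃ C : ℝ, 0 < C ∧ ∀ x t : EuclideanSpace ℝ (Fin d),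
      ‖g (x + (1 / 2 : ℝ) • t)‖ * ‖g (x - (1 / 2 : ℝ) • t)‖ ≤
        C * (1 + ‖x‖) ^ (-(m : ℝ)) * (1 + ‖t‖) ^ (-(m : ℝ)) := by
  obtain ⟨B, hB⟩ : ∃ B : ℝ, ∀ u, (1 + ‖u‖) ^ (2 * m) * ‖g u‖ ≤ B := by
    refine ⟨2 ^ (2 * m) * (Finset.Iic (2 * m, 0)).sup (fun p => SchwartzMap.seminorm ℝ p.1 p.2) g,
      fun u => ?_⟩
    simpa using SchwartzMap.one_add_le_sup_seminorm_apply (𝕜 := ℝ) (m := (2 * m, 0)) le_rfl le_rfl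
      g u
  have hB0 : 0 ≤ B := le_trans (by positivity) (hB 0)
  refine ⟨B ^ 2 + 1, by positivity, fun x t => ?_⟩
  set a := x + (1 / 2 : ℝ) • t with ha
  set b := x - (1 / 2 : ℝ) • t with hb
  have hx : ‖x‖ ≤ ‖a‖ + ‖b‖ := by
    have h1 : x = (1 / 2 : ℝ) • (a + b) := by rw [ha, hb]; module
    have h2 : ‖x‖ = 1 / 2 * ‖a + b‖ := by
      conv_lhs => rw [h1]
      rw [norm_smul]; norm_num
    have := norm_add_le a b
    have := norm_nonneg (a + b)
    linarith
  have ht : ‖t‖ ≤ ‖a‖ + ‖b‖ := by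
    have h1 : t = a - b := by rw [ha, hb]; module
    rw [h1]; exact norm_sub_le a b
  have hab : 0 ≤ ‖a‖ * ‖b‖ := by positivity
  rw [Real.rpow_neg (by positivity), Real.rpow_neg (by positivity), Real.rpow_natCast,
    Real.rpow_natCast, mul_assoc, ← mul_inv, ← div_eq_mul_inv, le_div_iff₀ (by positivity)]
  calc ‖g a‖ * ‖g b‖ * ((1 + ‖x‖) ^ m * (1 + ‖t‖) ^ m)
      ≤ ‖g a‖ * ‖g b‖ * (((1 + ‖a‖) * (1 + ‖b‖)) ^ m * ((1 + ‖a‖) * (1 + ‖b‖)) ^ m) := by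
        gcongr <;> nlinarith
    _ = ((1 + ‖a‖) ^ (2 * m) * ‖g a‖) * ((1 + ‖b‖) ^ (2 * m) * ‖g b‖) := by
        rw [two_mul, pow_add, pow_add, mul_pow]; ring
    _ ≤ B * B := mul_le_mul (hB a) (hB b) (by positivity) hB0
    _ ≤ B ^ 2 + 1 := by nlinarith

lemma norm_wigner_integrand (f : EuclideanSpace ℝ (Fin d) → ℂ) (x ξ t : EuclideanSpace ℝ (Fin d)) :
    ‖f (x + (1 / 2 : ℝ) • t) * (starRingEnd ℂ) (f (x - (1 / 2 : ℝ) • t)) *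
      Complex.exp (-Complex.I * ((inner ℝ ξ t : ℝ) : ℂ))‖ =
    ‖f (x + (1 / 2 : ℝ) • t)‖ * ‖f (x - (1 / 2 : ℝ) • t)‖ := by
  rw [norm_mul, norm_mul, RCLike.norm_conj,
    show -Complex.I * ((inner ℝ ξ t : ℝ) : ℂ) = ((-inner ℝ ξ t : ℝ) : ℂ) * Complex.I by
      push_cast; ring, Complex.norm_exp_ofReal_mul_I, mul_one]

lemma integrable_one_add_norm_rpow_of_lt {m : ℕ} (hm : d < m) :
    Integrable fun x : EuclideanSpace ℝ (Fin d) => (1 + ‖x‖) ^ (-(m : ℝ)) :=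
  integrable_one_add_norm (by simpa using hm)

lemma exists_norm_wigner_le (g : 𝓢(EuclideanSpace ℝ (Fin d), ℂ)) (k : ℕ) :
    ∃ C : ℝ, 0 < C ∧ ∀ x ξ, ‖wigner g x ξ‖ ≤ C * (1 + ‖x‖) ^ (-(k : ℝ)) := by
  obtain ⟨C, hC, hgC⟩ := exists_norm_mul_norm_le g (k + d + 1)
  set I := ∫ t : EuclideanSpace ℝ (Fin d), (1 + ‖t‖) ^ (-((k + d + 1 : ℕ) : ℝ))
  have hI : 0 ≤ I := integral_nonneg fun t => by positivity
  refine ⟨C * (I + 1), by positivity, fun x ξ => ?_⟩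
  have h1 : ‖wigner g x ξ‖ ≤ C * (1 + ‖x‖) ^ (-((k + d + 1 : ℕ) : ℝ)) * I := by
    rw [wigner, ← integral_const_mul]
    refine norm_integral_le_of_norm_le
      ((integrable_one_add_norm_rpow_of_lt (by omega)).const_mul _) (.of_forall fun t => ?_)
    rw [norm_wigner_integrand]
    exact hgC x t
  refine h1.trans ?_
  have h2 : (1 + ‖x‖) ^ (-((k + d + 1 : ℕ) : ℝ)) ≤ (1 + ‖x‖) ^ (-(k : ℝ)) :=
    Real.rpow_le_rpow_of_exponent_le (by simp) (by push_cast; linarith [d.cast_nonneg (α := ℝ)])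
  have h3 : 0 ≤ (1 + ‖x‖) ^ (-(k : ℝ)) := by positivity
  calc _ ≤ C * (1 + ‖x‖) ^ (-(k : ℝ)) * (I + 1) := by gcongr; linarith
    _ = _ := by ring

lemma continuous_wigner (g : 𝓢(EuclideanSpace ℝ (Fin d), ℂ)) :
    Continuous fun z : EuclideanSpace ℝ (Fin d) × EuclideanSpace ℝ (Fin d) =>
      wigner g z.1 z.2 := by
  obtain ⟨C, hC, hgC⟩ := exists_norm_mul_norm_le g (d + 1)
  have hg := g.continuous
  unfold wigner
  refine continuous_of_dominated (bound := fun t => C * (1 + ‖t‖) ^ (-((d + 1 : ℕ) : ℝ)))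
    (fun z => Continuous.aestronglyMeasurable (by fun_prop)) (fun z => .of_forall fun t => ?_)
    ((integrable_one_add_norm_rpow_of_lt (by omega)).const_mul _)
    (.of_forall fun t => by fun_prop)
  rw [norm_wigner_integrand]
  refine (hgC z.1 t).trans ?_
  gcongr
  refine mul_le_of_le_one_right hC.le ?_
  exact Real.rpow_le_one_of_one_le_of_nonpos (by simp) (by simp; linarith [d.cast_nonneg (α := ℝ)])

lemma isCompact_cube (r : ℝ) : IsCompact (cube d r) := by
  have h : cube d r = (PiLp.continuousLinearEquiv 2 ℝ fun _ : Fin d => ℝ) ⁻¹'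
      Metric.closedBall 0 r := by
    ext ξ
    rw [Set.mem_preimage, mem_closedBall_zero_iff]
    rfl
  rw [h]
  exact (PiLp.continuousLinearEquiv 2 ℝ fun _ : Fin d => ℝ).toHomeomorph.isCompact_preimage.2
    (isCompact_closedBall 0 r)

lemma ofReal_mul_eq_ofReal_mul_toReal {a : ℝ} (ha : 0 ≤ a) {K : ℝ≥0∞} (hK : K < ∞) :
    ENNReal.ofReal a * K = ENNReal.ofReal (a * K.toReal) := by
  rw [ENNReal.ofReal_mul ha, ENNReal.ofReal_toReal hK.ne]

lemma eLpNorm_indicator_one_lt_top {s : Set (EuclideanSpace ℝ (Fin d))} (hs : MeasurableSet s)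
    (hμ : volume s ≠ ∞) (p : ℝ≥0∞) :
    eLpNorm (s.indicator fun _ => (1 : ℝ)) p volume < ∞ :=
  (memLp_indicator_const p hs (1 : ℝ) (Or.inr hμ)).2

lemma eLpNorm_indicator_one_ne_zero {s : Set (EuclideanSpace ℝ (Fin d))} (hs : MeasurableSet s)
    (hμ : volume s ≠ 0) {p : ℝ≥0∞} (hp : p ≠ 0) :
    eLpNorm (s.indicator fun _ => (1 : ℝ)) p volume ≠ 0 := by
  rw [Ne, eLpNorm_eq_zero_iff ((measurable_const.indicator hs).aestronglyMeasurable) hp]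
  refine fun h => hμ (measure_mono_null (fun x hx => ?_) h)
  simp [hx]

/-- The Wigner transform vanishes for `ξ` outside the compact cube and decays in `x` uniformly in
`ξ`, so the weight costs exactly `r ^ n`. -/
lemma BandLimited.exists_mixedNorm_le {r : ℝ} (hr : 0 < r) (p q : ℝ≥0∞)
    {g : 𝓢(EuclideanSpace ℝ (Fin d), ℂ)} (hg : BandLimited r g) :
    ∃ C : ℝ, 0 < C ∧ ∀ n : ℕ,
      mixedNorm p q (fun x ξ => ((supNorm ξ ^ n : ℝ) : ℂ) * wigner g x ξ) ≤
        ENNReal.ofReal (C * r ^ n) := by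
  obtain ⟨k, hk⟩ := exists_eLpNorm_one_add_norm_lt_top (d := d) p
  obtain ⟨C, hC, hgC⟩ := exists_norm_wigner_le g k
  set K := eLpNorm (fun x : EuclideanSpace ℝ (Fin d) => (1 + ‖x‖) ^ (-(k : ℝ))) p volume
  set N := eLpNorm ((cube d r).indicator fun _ => (1 : ℝ)) q volume
  have hN : N < ∞ := eLpNorm_indicator_one_lt_top (isClosed_cube r).measurableSet
    (isCompact_cube r).measure_lt_top.ne q
  refine ⟨C * (K.toReal + 1) * (N.toReal + 1), by positivity, fun n => ?_⟩
  have hin (ξ : EuclideanSpace ℝ (Fin d)) :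
      ‖eLpNorm (fun x => ((supNorm ξ ^ n : ℝ) : ℂ) * wigner g x ξ) p volume‖ₑ ≤
        ‖((C * (K.toReal + 1) * r ^ n) • (cube d r).indicator (fun _ => (1 : ℝ))) ξ‖ₑ := by
    rw [enorm_eq_self]
    by_cases hξ : ξ ∈ cube d r
    · have h0 : 0 ≤ supNorm ξ := norm_nonneg _
      have h1 := eLpNorm_le_mul_eLpNorm_of_ae_le_mul (μ := volume)
        (f := fun x => ((supNorm ξ ^ n : ℝ) : ℂ) * wigner g x ξ)
        (g := fun x : EuclideanSpace ℝ (Fin d) => (1 + ‖x‖) ^ (-(k : ℝ)))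
        (c := C * r ^ n) (.of_forall fun x => by
          rw [Real.norm_of_nonneg (by positivity : 0 ≤ (1 + ‖x‖) ^ (-(k : ℝ))), norm_mul,
            Complex.norm_real, Real.norm_of_nonneg (by positivity)]
          calc _ ≤ r ^ n * (C * (1 + ‖x‖) ^ (-(k : ℝ))) := by
                gcongr
                · exact hξ
                · exact hgC x ξ
            _ = _ := by ring) p
      refine h1.trans ?_
      rw [ofReal_mul_eq_ofReal_mul_toReal (by positivity) hk, Pi.smul_apply,
        Set.indicator_of_mem hξ, smul_eq_mul, mul_one, Real.enorm_of_nonneg (by positivity)]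
      refine ENNReal.ofReal_le_ofReal ?_
      have : 0 ≤ C * r ^ n := by positivity
      change C * r ^ n * K.toReal ≤ _
      nlinarith
    · have h1 : (fun x => ((supNorm ξ ^ n : ℝ) : ℂ) * wigner g x ξ) = 0 := by
        ext x
        have : wigner g x ξ = 0 := by
          by_contra h
          exact hξ (hg.supNorm_le_of_wigner_ne_zero hr.le h)
        simp [this]
      rw [h1]
      simp
  refine (eLpNorm_mono_enorm hin).trans ?_
  rw [eLpNorm_const_smul, Real.enorm_of_nonneg (by positivity),
    ofReal_mul_eq_ofReal_mul_toReal (by positivity) hN]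
  refine ENNReal.ofReal_le_ofReal ?_
  have : 0 ≤ C * (K.toReal + 1) * r ^ n := by positivity
  change C * (K.toReal + 1) * r ^ n * N.toReal ≤ _
  nlinarith

/-- By continuity, `|W| > b` and `|ξ|_∞ > t` on a product of balls; the mixed norm dominates that of
a multiple of its indicator. -/
lemma exists_le_mixedNorm {p q : ℝ≥0∞} (hp : p ≠ 0) (hq : q ≠ 0)
    (g : 𝓢(EuclideanSpace ℝ (Fin d), ℂ)) {t : ℝ} (ht : 0 < t) {x₀ ξ₀ : EuclideanSpace ℝ (Fin d)}
    (hw : wigner g x₀ ξ₀ ≠ 0) (hξ₀ : t < supNorm ξ₀) :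
    ∃ c : ℝ, 0 < c ∧ ∀ n : ℕ, ENNReal.ofReal (c * t ^ n) ≤
      mixedNorm p q (fun x ξ => ((supNorm ξ ^ n : ℝ) : ℂ) * wigner g x ξ) := by
  set b := ‖wigner g x₀ ξ₀‖ / 2
  have hb : 0 < b := by have := norm_pos_iff.2 hw; positivity
  have hev : ∀ᶠ z : EuclideanSpace ℝ (Fin d) × EuclideanSpace ℝ (Fin d) in 𝓝 (x₀, ξ₀),
      b < ‖wigner g z.1 z.2‖ ∧ t < supNorm z.2 := by
    refine Filter.Eventually.and ?_ ?_
    · exact (continuous_wigner g).norm.continuousAt.eventually_const_lt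
        (half_lt_self (norm_pos_iff.2 hw))
    · exact (continuous_supNorm.comp continuous_snd).continuousAt.eventually_const_lt hξ₀
  obtain ⟨δ, hδ, hball⟩ := Metric.eventually_nhds_iff_ball.1 hev
  have hball' : ∀ x ∈ Metric.ball x₀ δ, ∀ ξ ∈ Metric.ball ξ₀ δ,
      b < ‖wigner g x ξ‖ ∧ t < supNorm ξ := fun x hx ξ hξ => by
    refine hball (x, ξ) ?_
    rw [← ball_prod_same]
    exact ⟨hx, hξ⟩
  set K := eLpNorm ((Metric.ball x₀ δ).indicator fun _ => (1 : ℝ)) p volume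
  set N := eLpNorm ((Metric.ball ξ₀ δ).indicator fun _ => (1 : ℝ)) q volume
  have hK : K < ∞ := eLpNorm_indicator_one_lt_top measurableSet_ball measure_ball_lt_top.ne p
  have hN : N < ∞ := eLpNorm_indicator_one_lt_top measurableSet_ball measure_ball_lt_top.ne q
  have hK0 : 0 < K.toReal := ENNReal.toReal_pos (eLpNorm_indicator_one_ne_zero measurableSet_ball
    (Metric.measure_ball_pos _ _ hδ).ne' hp) hK.ne
  have hN0 : 0 < N.toReal := ENNReal.toReal_pos (eLpNorm_indicator_one_ne_zero measurableSet_ball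
    (Metric.measure_ball_pos _ _ hδ).ne' hq) hN.ne
  refine ⟨b * K.toReal * N.toReal, by positivity, fun n => ?_⟩
  have hin (ξ : EuclideanSpace ℝ (Fin d)) :
      ‖((t ^ n * b * K.toReal) • (Metric.ball ξ₀ δ).indicator (fun _ => (1 : ℝ))) ξ‖ₑ ≤
      ‖eLpNorm (fun x => ((supNorm ξ ^ n : ℝ) : ℂ) * wigner g x ξ) p volume‖ₑ := by
    rw [enorm_eq_self]
    by_cases hξ : ξ ∈ Metric.ball ξ₀ δ
    · have h1 : eLpNorm ((t ^ n * b) • (Metric.ball x₀ δ).indicator (fun _ => (1 : ℝ))) p volume ≤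
          eLpNorm (fun x => ((supNorm ξ ^ n : ℝ) : ℂ) * wigner g x ξ) p volume := by
        refine eLpNorm_mono fun x => ?_
        by_cases hx : x ∈ Metric.ball x₀ δ
        · obtain ⟨h1, h2⟩ := hball' x hx ξ hξ
          rw [Pi.smul_apply, Set.indicator_of_mem hx, smul_eq_mul, mul_one,
            norm_mul (((supNorm ξ ^ n : ℝ) : ℂ)), Complex.norm_real,
            Real.norm_of_nonneg (pow_nonneg (ht.trans h2).le n),
            Real.norm_of_nonneg (by positivity)]
          exact mul_le_mul (pow_le_pow_left₀ ht.le h2.le n) h1.le hb.le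
            (pow_nonneg (ht.trans h2).le n)
        · rw [Pi.smul_apply, Set.indicator_of_notMem hx, smul_zero, norm_zero]
          exact norm_nonneg _
      rw [eLpNorm_const_smul, Real.enorm_of_nonneg (by positivity)] at h1
      refine le_trans (le_of_eq ?_) h1
      rw [Pi.smul_apply, Set.indicator_of_mem hξ, smul_eq_mul, mul_one,
        Real.enorm_of_nonneg (by positivity), ofReal_mul_eq_ofReal_mul_toReal (by positivity) hK]
    · rw [Pi.smul_apply, Set.indicator_of_notMem hξ, smul_zero, enorm_zero]
      exact zero_le
  refine le_trans (le_of_eq ?_) (eLpNorm_mono_enorm hin)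
  rw [eLpNorm_const_smul, Real.enorm_of_nonneg (by positivity)]
  rw [ofReal_mul_eq_ofReal_mul_toReal (by positivity) hN]
  congr 1
  ring

lemma BandLimited.tendsto_mixedNorm {r : ℝ} (hr : 0 < r) {p q : ℝ≥0∞} (hp : 1 ≤ p) (hq : 1 ≤ q)
    {g : 𝓢(EuclideanSpace ℝ (Fin d), ℂ)} (hg : BandLimited r g)
    (hex : ∀ t, 0 < t → t < r → ∃ ξ j, 𝓕 g ξ ≠ 0 ∧ t < |2 * Real.pi * ξ j|) :
    Tendsto (fun n : ℕ =>
      mixedNorm p q (fun x ξ => ((supNorm ξ ^ n : ℝ) : ℂ) * wigner g x ξ) ^ (1 / (n : ℝ)))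
      atTop (𝓝 (ENNReal.ofReal r)) := by
  refine tendsto_rpow_inv_of_bounds hr ?_ fun t ht htr => ?_
  · obtain ⟨C, hC, h⟩ := hg.exists_mixedNorm_le hr p q
    exact ⟨C, hC, 0, fun n => by simpa using h n⟩
  · obtain ⟨ζ, j, hζ, hj⟩ := hex t ht htr
    obtain ⟨x, hx⟩ := exists_wigner_ne_zero g hζ
    have hs : t < supNorm ((2 * Real.pi) • ζ) := by
      by_contra! h
      have := (supNorm_le_iff ht.le).1 h j
      rw [PiLp.smul_apply, smul_eq_mul] at this
      linarith
    obtain ⟨c, hc, h⟩ := exists_le_mixedNorm (p := p) (q := q) (by positivity) (by positivity)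
      g ht hx hs
    exact ⟨c, hc, 0, fun n => by simpa using h n⟩

lemma mixedNorm_wigner_zero (p q : ℝ≥0∞) (n : ℕ) :
    mixedNorm p q (fun x ξ => ((supNorm ξ ^ n : ℝ) : ℂ) *
      wigner (0 : 𝓢(EuclideanSpace ℝ (Fin d), ℂ)) x ξ) = 0 := by
  simp [mixedNorm, wigner]

/-! ### The Fourier–Laplace integral as entire extension -/

lemma inner_le_cubeSupportFun {R : ℝ} (x : EuclideanSpace ℝ (Fin d))
    {y : EuclideanSpace ℝ (Fin d)} (hy : y ∈ cube d R) : inner ℝ x y ≤ cubeSupportFun R x := by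
  refine le_csSup ?_ ⟨y, hy, rfl⟩
  exact ((isCompact_cube R).image (by fun_prop)).bddAbove

/-- The linear functional `z ↦ 2πi ∑ z_j η_j` on `ℂ^d`. -/
def phase (η : EuclideanSpace ℝ (Fin d)) : EuclideanSpace ℂ (Fin d) →L[ℂ] ℂ :=
  ∑ j, (2 * Real.pi * Complex.I * (η j : ℂ)) • (EuclideanSpace.proj j : _ →L[ℂ] ℂ)

lemma phase_apply (η : EuclideanSpace ℝ (Fin d)) (z : EuclideanSpace ℂ (Fin d)) :
    phase η z = 2 * Real.pi * Complex.I * ∑ j, z j * (η j : ℂ) := by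
  simp only [phase, sum_apply, smul_apply, PiLp.proj_apply, smul_eq_mul, Finset.mul_sum]
  exact Finset.sum_congr rfl fun j _ => by ring

lemma continuous_phase : Continuous (phase : EuclideanSpace ℝ (Fin d) → _) := by
  unfold phase; fun_prop

lemma re_phase (η : EuclideanSpace ℝ (Fin d)) (z : EuclideanSpace ℂ (Fin d)) :
    (phase η z).re = inner ℝ (imPart z) (-(2 * Real.pi) • η) := by
  rw [phase_apply, Finset.mul_sum, Complex.re_sum, PiLp.inner_apply]
  refine Finset.sum_congr rfl fun j _ => ?_
  simp [imPart]
  ring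

lemma phase_toComplex (η x : EuclideanSpace ℝ (Fin d)) :
    phase η (toComplex x) = ((2 * Real.pi * inner ℝ η x : ℝ) : ℂ) * Complex.I := by
  rw [phase_apply, PiLp.inner_apply]
  simp [toComplex]
  ring

/-- The Fourier–Laplace integral `z ↦ ∫ 𝓕 g η e^{2πi z·η} dη`. -/
def entireExtension (g : 𝓢(EuclideanSpace ℝ (Fin d), ℂ)) (z : EuclideanSpace ℂ (Fin d)) : ℂ :=
  ∫ η, 𝓕 g η * Complex.exp (phase η z)

lemma entireExtension_toComplex (g : 𝓢(EuclideanSpace ℝ (Fin d), ℂ))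
    (x : EuclideanSpace ℝ (Fin d)) : entireExtension g (toComplex x) = g x := by
  have h1 : g x = 𝓕⁻ (𝓕 g : 𝓢(EuclideanSpace ℝ (Fin d), ℂ)) x := by
    rw [FourierTransform.fourierInv_fourier_eq]
  rw [h1, SchwartzMap.fourierInv_coe, Real.fourierInv_eq', entireExtension]
  refine integral_congr_ae (.of_forall fun η => ?_)
  simp only [phase_toComplex, smul_eq_mul]
  rw [mul_comm]

lemma BandLimited.hasCompactSupport {r : ℝ} {g : 𝓢(EuclideanSpace ℝ (Fin d), ℂ)}
    (hg : BandLimited r g) : HasCompactSupport (𝓕 g : 𝓢(EuclideanSpace ℝ (Fin d), ℂ)) := by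
  by_cases hr : 0 ≤ r
  · refine HasCompactSupport.intro (isCompact_cube (r / (2 * Real.pi))) fun η hη => ?_
    by_contra h
    refine hη ((supNorm_le_iff (by positivity)).2 fun j => ?_)
    rw [le_div_iff₀ (by positivity), mul_comm, ← abs_of_pos Real.two_pi_pos, ← abs_mul]
    exact hg η h j
  · refine HasCompactSupport.intro (isCompact_cube 0) fun η hη => ?_
    by_contra h
    refine hη ((supNorm_le_iff le_rfl).2 fun j => ?_)
    exact absurd ((abs_nonneg _).trans (hg η h j)) hr

lemma BandLimited.differentiable_entireExtension {r : ℝ} {g : 𝓢(EuclideanSpace ℝ (Fin d), ℂ)}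
    (hg : BandLimited r g) : Differentiable ℂ (entireExtension g) := by
  intro z
  have hc := hg.hasCompactSupport
  have hcont := (𝓕 g).continuous
  have hph := continuous_phase (d := d)
  refine (hasFDerivAt_integral_of_dominated_of_fderiv_le
    (F := fun z η => 𝓕 g η * Complex.exp (phase η z))
    (F' := fun z η => (𝓕 g η * Complex.exp (phase η z)) • phase η)
    (bound := fun η => ‖𝓕 g η‖ * (Real.exp (‖phase η‖ * (‖z‖ + 1)) * ‖phase η‖))
    (Metric.ball_mem_nhds z one_pos) (.of_forall fun w => ?_) ?_ ?_
    (.of_forall fun η w hw => ?_) ?_ (.of_forall fun η w _ => ?_)).differentiableAt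
  · exact Continuous.aestronglyMeasurable (by fun_prop)
  · exact Continuous.integrable_of_hasCompactSupport (by fun_prop) hc.mul_right
  · exact Continuous.aestronglyMeasurable (by fun_prop)
  · rw [norm_smul, norm_mul, mul_assoc]
    gcongr
    rw [Complex.norm_exp]
    refine Real.exp_le_exp.2 ((Complex.re_le_norm _).trans ?_)
    refine ((phase η).le_opNorm w).trans ?_
    gcongr
    have h1 : ‖w - z‖ < 1 := by simpa [dist_eq_norm] using hw
    have h2 : ‖w‖ ≤ ‖z‖ + ‖w - z‖ := by
      simpa using norm_add_le z (w - z)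
    linarith
  · exact Continuous.integrable_of_hasCompactSupport (by fun_prop) hc.norm.mul_right
  · have h1 := ((phase η).hasFDerivAt (x := w)).cexp.const_mul (𝓕 g η)
    rwa [smul_smul] at h1

/-- The real part of the phase is the pairing of `Im z` with `-2πη`, a point of the symmetric cube.
-/
lemma BandLimited.norm_entireExtension_le {R : ℝ} (hR : 0 ≤ R)
    {g : 𝓢(EuclideanSpace ℝ (Fin d), ℂ)} (hg : BandLimited R g) (z : EuclideanSpace ℂ (Fin d)) :
    ‖entireExtension g z‖ ≤ (∫ η, ‖𝓕 g η‖) * Real.exp (cubeSupportFun R (imPart z)) := by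
  rw [entireExtension, ← integral_mul_const]
  refine norm_integral_le_of_norm_le ((𝓕 g).integrable.norm.mul_const _) (.of_forall fun η => ?_)
  rw [norm_mul, Complex.norm_exp]
  by_cases h : 𝓕 g η = 0
  · simp [h]
  · gcongr
    rw [re_phase]
    refine inner_le_cubeSupportFun _ ((supNorm_le_iff hR).2 fun j => ?_)
    have := hg η h j
    rwa [PiLp.smul_apply, smul_eq_mul, neg_mul, abs_neg]

lemma hasFDerivAt_phase_left (z : EuclideanSpace ℂ (Fin d)) (η : EuclideanSpace ℝ (Fin d)) :
    HasFDerivAt (fun η : EuclideanSpace ℝ (Fin d) => phase η z)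
      (∑ i, ((2 * Real.pi * Complex.I * z i) • (Complex.ofRealCLM.comp
        (EuclideanSpace.proj i : EuclideanSpace ℝ (Fin d) →L[ℝ] ℝ)))) η := by
  refine (ContinuousLinearMap.hasFDerivAt _).congr_of_eventuallyEq (.of_forall fun η => ?_)
  simp only [phase_apply, sum_apply, Finset.mul_sum]
  exact Finset.sum_congr rfl fun i _ => by simp; ring

lemma fderiv_exp_phase_left_single (z : EuclideanSpace ℂ (Fin d)) (η : EuclideanSpace ℝ (Fin d))
    (j : Fin d) :
    fderiv ℝ (fun η : EuclideanSpace ℝ (Fin d) => Complex.exp (phase η z)) η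
      (EuclideanSpace.single j 1) = 2 * Real.pi * Complex.I * z j * Complex.exp (phase η z) := by
  rw [(hasFDerivAt_phase_left z η).cexp.fderiv]
  simp only [smul_apply, sum_apply, ContinuousLinearMap.comp_apply, smul_eq_mul]
  rw [Finset.sum_eq_single j]
  · simp; ring
  · intro i _ hi; simp [hi]
  · simp

lemma integral_lineDeriv_mul_exp_phase {G : 𝓢(EuclideanSpace ℝ (Fin d), ℂ)}
    (hc : HasCompactSupport G) (j : Fin d) (z : EuclideanSpace ℂ (Fin d)) :
    ∫ η, (∂_{EuclideanSpace.single j (1 : ℝ)} G : 𝓢(EuclideanSpace ℝ (Fin d), ℂ)) η *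
      Complex.exp (phase η z) =
      -(2 * Real.pi * Complex.I * z j * ∫ η, G η * Complex.exp (phase η z)) := by
  have hcont := G.continuous
  set G' : 𝓢(EuclideanSpace ℝ (Fin d), ℂ) := ∂_{EuclideanSpace.single j (1 : ℝ)} G with hG'
  have hcont' := G'.continuous
  have hph := continuous_phase (d := d)
  have hcoe (η : EuclideanSpace ℝ (Fin d)) :
      fderiv ℝ G η (EuclideanSpace.single j 1) = G' η :=
    (SchwartzMap.lineDerivOp_apply_eq_fderiv _ _ _).symm
  have hc' : HasCompactSupport G' :=
    hc.mono' ((subset_tsupport _).trans (SchwartzMap.tsupport_lineDerivOp_subset _ _))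
  have hibp := integral_mul_fderiv_eq_neg_fderiv_mul_of_integrable (μ := volume) (f := G)
    (g := fun η : EuclideanSpace ℝ (Fin d) => Complex.exp (phase η z))
    (v := EuclideanSpace.single j 1)
    (by
      simp only [hcoe]
      exact Continuous.integrable_of_hasCompactSupport (by fun_prop) hc'.mul_right)
    (by
      simp only [fderiv_exp_phase_left_single]
      exact Continuous.integrable_of_hasCompactSupport (by fun_prop) hc.mul_right)
    (Continuous.integrable_of_hasCompactSupport (by fun_prop) hc.mul_right)
    (fun η _ => G.differentiableAt)
    (fun η _ => (hasFDerivAt_phase_left z η).cexp.differentiableAt)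
  simp only [fderiv_exp_phase_left_single, hcoe] at hibp
  rw [← integral_const_mul, eq_neg_iff_add_eq_zero, add_comm, ← eq_neg_iff_add_eq_zero, ← hibp]
  exact integral_congr_ae (.of_forall fun η => by simp only; ring)

/-- Integration by parts in `η`, without boundary terms thanks to compact support. Iterated, it
converts boundedness for all band-limited functions into polynomial decay. -/
lemma BandLimited.entireExtension_schwartzX {r : ℝ} {g : 𝓢(EuclideanSpace ℝ (Fin d), ℂ)}
    (hg : BandLimited r g) (j : Fin d) (z : EuclideanSpace ℂ (Fin d)) :
    entireExtension (schwartzX j g) z = z j * entireExtension g z := by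
  have h : entireExtension (schwartzX j g) z = Complex.I / (2 * Real.pi) *
      ∫ η, (∂_{EuclideanSpace.single j (1 : ℝ)} (𝓕 g) : 𝓢(EuclideanSpace ℝ (Fin d), ℂ)) η *
        Complex.exp (phase η z) := by
    rw [entireExtension, fourier_schwartzX, ← integral_const_mul]
    exact integral_congr_ae (.of_forall fun η => by simp [mul_assoc])
  rw [h, integral_lineDeriv_mul_exp_phase hg.hasCompactSupport, entireExtension]
  have : (Real.pi : ℂ) ≠ 0 := by exact_mod_cast Real.pi_ne_zero
  field_simp
  rw [Complex.I_sq]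
  ring

lemma BandLimited.exists_norm_pow_mul_entireExtension_le {R : ℝ} (hR : 0 ≤ R) (j : Fin d) (k : ℕ) :
    ∀ {g : 𝓢(EuclideanSpace ℝ (Fin d), ℂ)}, BandLimited R g → ∃ C : ℝ, 0 ≤ C ∧ ∀ z,
      ‖z j‖ ^ k * ‖entireExtension g z‖ ≤ C * Real.exp (cubeSupportFun R (imPart z)) := by
  induction k with
  | zero =>
    intro g hg
    exact ⟨_, integral_nonneg fun _ => norm_nonneg _, fun z => by
      simpa using hg.norm_entireExtension_le hR z⟩
  | succ k ih =>
    intro g hg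
    obtain ⟨C, hC, h⟩ := ih (hg.mul_coord j)
    refine ⟨C, hC, fun z => ?_⟩
    have := h z
    rwa [hg.entireExtension_schwartzX, norm_mul, ← mul_assoc, ← pow_succ] at this

lemma BandLimited.exists_norm_entireExtension_le {R : ℝ} (hR : 0 ≤ R)
    {g : 𝓢(EuclideanSpace ℝ (Fin d), ℂ)} (hg : BandLimited R g) (k : ℕ) :
    ∃ C : ℝ, 0 < C ∧ ∀ z, ‖entireExtension g z‖ ≤
      C * (1 + ‖z‖) ^ (-(k : ℤ)) * Real.exp (cubeSupportFun R (imPart z)) := by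
  choose C hC h using fun j => BandLimited.exists_norm_pow_mul_entireExtension_le hR j k hg
  set B := ∫ η, ‖𝓕 g η‖
  have hB : 0 ≤ B := integral_nonneg fun _ => norm_nonneg _
  have hsum : 0 ≤ ∑ j, C j := Finset.sum_nonneg fun j _ => hC j
  refine ⟨((d : ℝ) + 1) ^ k * (B + ∑ j, C j) + 1, by positivity, fun z => ?_⟩
  set e := Real.exp (cubeSupportFun R (imPart z))
  have he : 0 < e := Real.exp_pos _
  have h1 : (1 + ‖z‖) ^ k * ‖entireExtension g z‖ ≤
      (((d : ℝ) + 1) ^ k * (B + ∑ j, C j) + 1) * e := by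
    calc (1 + ‖z‖) ^ k * ‖entireExtension g z‖
        ≤ ((d : ℝ) + 1) ^ k * (1 + ∑ j, ‖z j‖ ^ k) * ‖entireExtension g z‖ := by
          gcongr; exact one_add_norm_pow_le k z
      _ = ((d : ℝ) + 1) ^ k *
          (‖entireExtension g z‖ + ∑ j, ‖z j‖ ^ k * ‖entireExtension g z‖) := by
          rw [← Finset.sum_mul]; ring
      _ ≤ ((d : ℝ) + 1) ^ k * (B * e + ∑ j, C j * e) :=
          mul_le_mul_of_nonneg_left (add_le_add (hg.norm_entireExtension_le hR z)
            (Finset.sum_le_sum fun j _ => h j z)) (by positivity)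
      _ = ((d : ℝ) + 1) ^ k * (B + ∑ j, C j) * e := by rw [← Finset.sum_mul]; ring
      _ ≤ _ := by nlinarith
  rw [zpow_neg, zpow_natCast, mul_right_comm, ← div_eq_mul_inv, le_div_iff₀ (by positivity),
    mul_comm]
  exact h1

/-! ### Complex shifts of the Fourier integral and the converse -/

/-- The inclusion of `ℝ^d` in `ℂ^d` as a linear isometry. -/
def toComplexₗᵢ : EuclideanSpace ℝ (Fin d) →ₗᵢ[ℝ] EuclideanSpace ℂ (Fin d) where
  toFun := toComplex
  map_add' x y := by ext j; simp [toComplex]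
  map_smul' c x := by ext j; simp [toComplex]
  norm_map' x := by
    change ‖toComplex x‖ = _
    simp [EuclideanSpace.norm_eq, toComplex]

lemma norm_toComplex (x : EuclideanSpace ℝ (Fin d)) : ‖toComplex x‖ = ‖x‖ :=
  toComplexₗᵢ.norm_map x

lemma continuous_toComplex : Continuous (toComplex : EuclideanSpace ℝ (Fin d) → _) :=
  toComplexₗᵢ.continuous

lemma toComplex_add (x y : EuclideanSpace ℝ (Fin d)) :
    toComplex (x + y) = toComplex x + toComplex y :=
  toComplexₗᵢ.map_add x y

lemma toComplex_single (a : ℝ) (j : Fin d) :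
    toComplex (EuclideanSpace.single j a) = (a : ℂ) • EuclideanSpace.single j (1 : ℂ) := by
  ext i
  by_cases h : i = j
  · subst h; simp [toComplex]
  · simp [toComplex, h]

lemma cubeSupportFun_le {R : ℝ} (hR : 0 ≤ R) (x : EuclideanSpace ℝ (Fin d)) (s : ℂ) (j : Fin d) :
    cubeSupportFun R (imPart (toComplex x + s • EuclideanSpace.single j (1 : ℂ))) ≤ R * |s.im| := by
  have h1 : imPart (toComplex x + s • EuclideanSpace.single j (1 : ℂ)) =
      EuclideanSpace.single j s.im := by
    ext i
    by_cases h : i = j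
    · subst h; simp [toComplex, imPart]
    · simp [toComplex, imPart, h]
  rw [h1]
  refine csSup_le ⟨_, 0, (supNorm_le_iff hR).2 (by simpa using fun _ => hR), rfl⟩ ?_
  rintro _ ⟨y, hy, rfl⟩
  simp only [EuclideanSpace.inner_single_left, conj_trivial]
  calc s.im * y j ≤ |s.im| * |y j| := by rw [← abs_mul]; exact le_abs_self _
    _ ≤ |s.im| * R := by gcongr; exact (supNorm_le_iff hR).1 hy j
    _ = _ := mul_comm _ _

lemma one_add_norm_le_mul (x : EuclideanSpace ℝ (Fin d)) (s : ℂ) (j : Fin d) :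
    1 + ‖x‖ ≤ (1 + ‖toComplex x + s • EuclideanSpace.single j (1 : ℂ)‖) * (1 + ‖s‖) := by
  have h1 := norm_sub_le (toComplex x + s • EuclideanSpace.single j (1 : ℂ))
    (s • EuclideanSpace.single j (1 : ℂ))
  rw [add_sub_cancel_right, norm_toComplex, norm_smul] at h1
  simp only [PiLp.norm_single, norm_one, mul_one] at h1
  nlinarith [norm_nonneg s, norm_nonneg (toComplex x + s • EuclideanSpace.single j (1 : ℂ))]

/-- The integrand of the Fourier transform of `F`, with the `j`-th variable shifted by `s`. -/
def shiftedIntegrand (F : EuclideanSpace ℂ (Fin d) → ℂ) (ξ : EuclideanSpace ℝ (Fin d)) (j : Fin d)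
    (s : ℂ) (x : EuclideanSpace ℝ (Fin d)) : ℂ :=
  F (toComplex x + s • EuclideanSpace.single j (1 : ℂ)) *
    Complex.exp (-(2 * Real.pi * Complex.I) * ((inner ℝ x ξ : ℝ) + s * (ξ j : ℂ)))

lemma norm_shiftedIntegrand_le {F : EuclideanSpace ℂ (Fin d) → ℂ} {R C : ℝ} (hR : 0 ≤ R)
    (hC : 0 ≤ C) {k : ℕ} (hF : ∀ z, ‖F z‖ ≤ C * (1 + ‖z‖) ^ (-(k : ℤ)) *
      Real.exp (cubeSupportFun R (imPart z))) (ξ : EuclideanSpace ℝ (Fin d)) (j : Fin d) (s : ℂ)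
    (x : EuclideanSpace ℝ (Fin d)) :
    ‖shiftedIntegrand F ξ j s x‖ ≤ C * (1 + ‖s‖) ^ k *
      Real.exp (R * |s.im| + 2 * Real.pi * ξ j * s.im) * (1 + ‖x‖) ^ (-(k : ℝ)) := by
  rw [shiftedIntegrand, norm_mul, Complex.norm_exp]
  have hre : (-(2 * Real.pi * Complex.I) * ((inner ℝ x ξ : ℝ) + s * (ξ j : ℂ))).re =
      2 * Real.pi * ξ j * s.im := by
    simp; ring
  rw [hre, Real.exp_add]
  have h1 := hF (toComplex x + s • EuclideanSpace.single j (1 : ℂ))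
  set w := toComplex x + s • EuclideanSpace.single j (1 : ℂ)
  have h2 : Real.exp (cubeSupportFun R (imPart w)) ≤ Real.exp (R * |s.im|) :=
    Real.exp_le_exp.2 (cubeSupportFun_le hR x s j)
  have h3 : (1 + ‖w‖) ^ (-(k : ℤ)) ≤ (1 + ‖s‖) ^ k * (1 + ‖x‖) ^ (-(k : ℝ)) := by
    rw [zpow_neg, zpow_natCast, Real.rpow_neg (by positivity), Real.rpow_natCast,
      ← div_eq_mul_inv, le_div_iff₀ (by positivity), mul_comm, ← div_eq_mul_inv,
      div_le_iff₀ (by positivity), ← mul_pow]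
    refine pow_le_pow_left₀ (by positivity) ?_ k
    rw [mul_comm]
    exact one_add_norm_le_mul x s j
  calc ‖F w‖ * Real.exp (2 * Real.pi * ξ j * s.im)
      ≤ C * ((1 + ‖s‖) ^ k * (1 + ‖x‖) ^ (-(k : ℝ))) * Real.exp (R * |s.im|) *
        Real.exp (2 * Real.pi * ξ j * s.im) := by
        gcongr
        exact h1.trans (by gcongr)
    _ = _ := by ring

lemma continuous_shiftedIntegrand {F : EuclideanSpace ℂ (Fin d) → ℂ} (hF : Continuous F)
    (ξ : EuclideanSpace ℝ (Fin d)) (j : Fin d) :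
    Continuous fun z : EuclideanSpace ℝ (Fin d) × ℂ => shiftedIntegrand F ξ j z.2 z.1 := by
  have := continuous_toComplex (d := d)
  unfold shiftedIntegrand
  fun_prop

lemma differentiable_shiftedIntegrand {F : EuclideanSpace ℂ (Fin d) → ℂ} (hF : Differentiable ℂ F)
    (ξ : EuclideanSpace ℝ (Fin d)) (j : Fin d) (x : EuclideanSpace ℝ (Fin d)) :
    Differentiable ℂ fun s => shiftedIntegrand F ξ j s x := by
  unfold shiftedIntegrand
  fun_prop

lemma shiftedIntegrand_add_ofReal (F : EuclideanSpace ℂ (Fin d) → ℂ)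
    (ξ : EuclideanSpace ℝ (Fin d)) (j : Fin d) (s : ℂ) (a : ℝ) (x : EuclideanSpace ℝ (Fin d)) :
    shiftedIntegrand F ξ j (s + a) x =
      shiftedIntegrand F ξ j s (x + EuclideanSpace.single j a) := by
  unfold shiftedIntegrand
  rw [toComplex_add, toComplex_single, inner_add_left, EuclideanSpace.inner_single_left, add_smul,
    add_comm (s • _), ← add_assoc]
  congr 2
  simp only [conj_trivial]
  push_cast
  ring

lemma hasDerivAt_integral_shiftedIntegrand {F : EuclideanSpace ℂ (Fin d) → ℂ}
    (hF : Differentiable ℂ F) {R C : ℝ} (hR : 0 ≤ R) (hC : 0 ≤ C)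
    (hFC : ∀ z, ‖F z‖ ≤ C * (1 + ‖z‖) ^ (-((d + 1 : ℕ) : ℤ)) *
      Real.exp (cubeSupportFun R (imPart z))) (ξ : EuclideanSpace ℝ (Fin d)) (j : Fin d) (s : ℂ) :
    HasDerivAt (fun s => ∫ x, shiftedIntegrand F ξ j s x)
      (∫ x, deriv (fun s => shiftedIntegrand F ξ j s x) s) s := by
  have hcont := continuous_shiftedIntegrand hF.continuous ξ j
  have hmeas (s : ℂ) : AEStronglyMeasurable (shiftedIntegrand F ξ j s) :=
    (hcont.comp (continuous_id.prodMk continuous_const)).aestronglyMeasurable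
  have hint := integrable_one_add_norm_rpow_of_lt (d := d) (m := d + 1) (by omega)
  have hbound := norm_shiftedIntegrand_le hR hC hFC ξ j
  -- The radius `‖s‖ + 2` contains every unit circle centred in the unit ball about `s`, so Cauchy's
  -- estimate bounds the derivatives by the same majorant.
  set B := C * (1 + (‖s‖ + 2)) ^ (d + 1) *
    Real.exp (R * (‖s‖ + 2) + 2 * Real.pi * |ξ j| * (‖s‖ + 2)) with hB
  have hball : ∀ w : ℂ, ‖w‖ ≤ ‖s‖ + 2 → ∀ x,
      ‖shiftedIntegrand F ξ j w x‖ ≤ B * (1 + ‖x‖) ^ (-((d + 1 : ℕ) : ℝ)) := by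
    intro w hw x
    refine (hbound w x).trans ?_
    rw [hB]
    have h1 : |w.im| ≤ ‖s‖ + 2 := (Complex.abs_im_le_norm w).trans hw
    have h2 : 2 * Real.pi * ξ j * w.im ≤ 2 * Real.pi * |ξ j| * (‖s‖ + 2) := by
      calc 2 * Real.pi * ξ j * w.im ≤ |2 * Real.pi * ξ j * w.im| := le_abs_self _
        _ = 2 * Real.pi * |ξ j| * |w.im| := by
          rw [abs_mul, abs_mul, abs_of_pos Real.two_pi_pos]
        _ ≤ _ := by gcongr
    gcongr
  refine (hasDerivAt_integral_of_dominated_loc_of_deriv_le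
    (F' := fun s x => deriv (fun s => shiftedIntegrand F ξ j s x) s)
    (bound := fun x => B * (1 + ‖x‖) ^ (-((d + 1 : ℕ) : ℝ)))
    (Metric.ball_mem_nhds s one_pos) (.of_forall hmeas) ?_ ?_ (.of_forall fun x w hw => ?_)
    (hint.const_mul _) (.of_forall fun x w _ => ?_)).2
  · exact (hint.const_mul _).mono' (hmeas s) (.of_forall fun x => hbound s x)
  · exact ((stronglyMeasurable_deriv_with_param
      (f := fun x s => shiftedIntegrand F ξ j s x) hcont).comp_measurable
      (measurable_id.prodMk measurable_const)).aestronglyMeasurable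
  · have h1 := Complex.norm_deriv_le_of_forall_mem_sphere_norm_le (c := w) one_pos
      (differentiable_shiftedIntegrand hF ξ j x).diffContOnCl
      (C := B * (1 + ‖x‖) ^ (-((d + 1 : ℕ) : ℝ))) fun v hv => hball v ?_ x
    · simpa using h1
    · have hv' : ‖v - w‖ = 1 := by simpa [dist_eq_norm] using hv
      have hw' : ‖w - s‖ < 1 := by simpa [dist_eq_norm] using hw
      have h2 := norm_add_le (v - w) w
      have h3 := norm_add_le (w - s) s
      rw [sub_add_cancel] at h2 h3
      linarith
  · exact (differentiable_shiftedIntegrand hF ξ j x w).hasDerivAt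

/-- A real shift of `s` is a translation of `x` and leaves the integral unchanged. The integral is
entire in `s`, so its complex derivative can be computed along the real direction, where it is zero.
-/
lemma integral_shiftedIntegrand_eq {F : EuclideanSpace ℂ (Fin d) → ℂ}
    (hF : Differentiable ℂ F) {R C : ℝ} (hR : 0 ≤ R) (hC : 0 ≤ C)
    (hFC : ∀ z, ‖F z‖ ≤ C * (1 + ‖z‖) ^ (-((d + 1 : ℕ) : ℤ)) *
      Real.exp (cubeSupportFun R (imPart z))) (ξ : EuclideanSpace ℝ (Fin d)) (j : Fin d) (s : ℂ) :
    ∫ x, shiftedIntegrand F ξ j s x = ∫ x, shiftedIntegrand F ξ j 0 x := by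
  have hder := hasDerivAt_integral_shiftedIntegrand hF hR hC hFC ξ j
  refine is_const_of_deriv_eq_zero (f := fun s => ∫ x, shiftedIntegrand F ξ j s x)
    (fun w => (hder w).differentiableAt) (fun w => ?_) s 0
  have htrans (a : ℝ) : ∫ x, shiftedIntegrand F ξ j (w + a) x = ∫ x, shiftedIntegrand F ξ j w x := by
    simp_rw [shiftedIntegrand_add_ofReal]
    exact integral_add_right_eq_self (shiftedIntegrand F ξ j w) _
  have h1 : HasDerivAt (fun a : ℝ => w + (a : ℂ)) 1 0 :=
    (Complex.ofRealCLM.hasDerivAt (x := 0)).const_add w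
  have h2 := HasDerivAt.scomp_of_eq (0 : ℝ) (hder w) h1 (by simp)
  have h3 : HasDerivAt (fun _ : ℝ => ∫ x, shiftedIntegrand F ξ j w x)
      (deriv (fun s => ∫ x, shiftedIntegrand F ξ j s x) w) 0 := by
    rw [(hder w).deriv]
    refine (h2.congr_of_eventuallyEq (.of_forall fun a => (htrans a).symm)).congr_deriv ?_
    simp
  exact h3.unique (hasDerivAt_const _ _)

lemma fourier_eq_integral_shiftedIntegrand {F : EuclideanSpace ℂ (Fin d) → ℂ}
    {f : EuclideanSpace ℝ (Fin d) → ℂ} (hFf : ∀ x, F (toComplex x) = f x)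
    (ξ : EuclideanSpace ℝ (Fin d)) (j : Fin d) :
    𝓕 f ξ = ∫ x, shiftedIntegrand F ξ j 0 x := by
  rw [Real.fourier_eq']
  refine integral_congr_ae (.of_forall fun x => ?_)
  simp only [shiftedIntegrand, zero_smul, add_zero, zero_mul, hFf, smul_eq_mul]
  rw [mul_comm]
  congr 2
  push_cast
  ring

lemma fourier_eq_zero_of_entire {F : EuclideanSpace ℂ (Fin d) → ℂ}
    {f : EuclideanSpace ℝ (Fin d) → ℂ} (hF : Differentiable ℂ F)
    (hFf : ∀ x, F (toComplex x) = f x) {R C : ℝ} (hR : 0 ≤ R) (hC : 0 ≤ C)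
    (hFC : ∀ z, ‖F z‖ ≤ C * (1 + ‖z‖) ^ (-((d + 1 : ℕ) : ℤ)) *
      Real.exp (cubeSupportFun R (imPart z))) {ξ : EuclideanSpace ℝ (Fin d)} {j : Fin d}
    (hξ : R < |2 * Real.pi * ξ j|) : 𝓕 f ξ = 0 := by
  -- The sign `σ` directs the imaginary shift so that the exponential kernel decays; against the
  -- growth `e^{Rn}` of `F` there remains `e^{-n(|2πξ_j| - R)}`.
  obtain ⟨σ, hσ, hσξ⟩ : ∃ σ : ℝ, |σ| = 1 ∧ 2 * Real.pi * ξ j * σ = -|2 * Real.pi * ξ j| := by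
    rcases le_total 0 (2 * Real.pi * ξ j) with h | h
    · exact ⟨-1, by simp, by rw [abs_of_nonneg h]; ring⟩
    · exact ⟨1, by simp, by rw [abs_of_nonpos h]; ring⟩
  set I := ∫ x : EuclideanSpace ℝ (Fin d), (1 + ‖x‖) ^ (-((d + 1 : ℕ) : ℝ))
  refine norm_eq_zero.1 (eq_zero_of_forall_pow_mul_le (q := Real.exp (|2 * Real.pi * ξ j| - R))
    (C := C * I) (Real.one_lt_exp_iff.2 (by linarith)) (d + 1) (norm_nonneg _) fun n => ?_)
  set s : ℂ := ((σ * n : ℝ) : ℂ) * Complex.I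
  have him : s.im = σ * n := by simp [s]
  have him' : |s.im| = n := by rw [him, abs_mul, hσ, one_mul, Nat.abs_cast]
  have hs : ‖s‖ = n := by
    rw [norm_mul, Complex.norm_I, mul_one, Complex.norm_real, Real.norm_eq_abs, abs_mul, hσ,
      one_mul, Nat.abs_cast]
  have h1 : ‖𝓕 f ξ‖ ≤ C * (1 + (n : ℝ)) ^ (d + 1) *
      Real.exp (-(n * (|2 * Real.pi * ξ j| - R))) * I := by
    rw [fourier_eq_integral_shiftedIntegrand hFf ξ j,
      ← integral_shiftedIntegrand_eq hF hR hC hFC ξ j s, ← integral_const_mul]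
    refine norm_integral_le_of_norm_le
      ((integrable_one_add_norm_rpow_of_lt (by omega)).const_mul _) (.of_forall fun x => ?_)
    have h2 := norm_shiftedIntegrand_le hR hC hFC ξ j s x
    rw [him', hs, him, ← mul_assoc (2 * Real.pi * ξ j), hσξ] at h2
    convert h2 using 4
    ring
  rw [Real.exp_neg] at h1
  rw [← Real.exp_nat_mul]
  have he := Real.exp_pos (n * (|2 * Real.pi * ξ j| - R))
  calc _ ≤ Real.exp (n * (|2 * Real.pi * ξ j| - R)) * (C * (1 + (n : ℝ)) ^ (d + 1) *
      (Real.exp (n * (|2 * Real.pi * ξ j| - R)))⁻¹ * I) := by gcongr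
    _ = _ := by field_simp; ring

/-- No derivative of `f` is estimated: its moments are integrable, so `𝓕 f` is smooth, and it has
compact support. Thus `𝓕 f` is a Schwartz function, and `f` is its inverse transform. -/
lemma exists_bandLimited_of_entire {F : EuclideanSpace ℂ (Fin d) → ℂ}
    {f : EuclideanSpace ℝ (Fin d) → ℂ} (hF : Differentiable ℂ F)
    (hFf : ∀ x, F (toComplex x) = f x) {R : ℝ} (hR : 0 ≤ R)
    (hFC : ∀ k : ℕ, ∃ C : ℝ, 0 < C ∧ ∀ z, ‖F z‖ ≤ C * (1 + ‖z‖) ^ (-(k : ℤ)) *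
      Real.exp (cubeSupportFun R (imPart z))) :
    ∃ g : 𝓢(EuclideanSpace ℝ (Fin d), ℂ), (g : EuclideanSpace ℝ (Fin d) → ℂ) = f ∧
      BandLimited R g := by
  have hcont : Continuous f := by
    have : f = F ∘ toComplex := funext fun x => (hFf x).symm
    rw [this]
    exact hF.continuous.comp continuous_toComplex
  have hmoment (n : ℕ) : Integrable fun x => ‖x‖ ^ n * ‖f x‖ := by
    obtain ⟨C, hC, h⟩ := hFC (n + (d + 1))
    refine ((integrable_one_add_norm_rpow_of_lt (d := d) (m := d + 1) (by omega)).const_mul C).mono'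
      (by fun_prop) (.of_forall fun x => ?_)
    have h1 := h (toComplex x)
    have h2 : cubeSupportFun R (imPart (toComplex x)) ≤ 0 := by
      -- The coordinate bound needs an index; for `d = 0` the space is a single point.
      by_cases hd : Nonempty (Fin d)
      · simpa using cubeSupportFun_le hR x 0 hd.some
      · refine Real.sSup_nonpos ?_
        rintro _ ⟨y, -, rfl⟩
        rw [not_nonempty_iff] at hd
        simp [Subsingleton.elim y 0]
    rw [hFf, norm_toComplex, zpow_neg, zpow_natCast] at h1
    rw [norm_mul, norm_pow, norm_norm, norm_norm, Real.rpow_neg (by positivity), Real.rpow_natCast]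
    calc ‖x‖ ^ n * ‖f x‖ ≤ (1 + ‖x‖) ^ n * (C * ((1 + ‖x‖) ^ (n + (d + 1)))⁻¹ * 1) := by
          gcongr
          · linarith
          · refine h1.trans ?_
            gcongr
            exact Real.exp_le_one_iff.2 h2
      _ = _ := by rw [pow_add]; field_simp
  have hint : Integrable f := by
    have := hmoment 0
    simp only [pow_zero, one_mul] at this
    exact (integrable_norm_iff hcont.aestronglyMeasurable).1 this
  have hsupp : ∀ ξ, 𝓕 f ξ ≠ 0 → ∀ j, |2 * Real.pi * ξ j| ≤ R := by
    obtain ⟨C, hC, h⟩ := hFC (d + 1)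
    intro ξ hξ j
    by_contra! hj
    exact hξ (fourier_eq_zero_of_entire hF hFf hR hC.le h hj)
  have hcs : HasCompactSupport (𝓕 f) := by
    refine HasCompactSupport.intro (isCompact_cube (R / (2 * Real.pi))) fun η hη => ?_
    by_contra h
    refine hη ((supNorm_le_iff (by positivity)).2 fun j => ?_)
    rw [le_div_iff₀ (by positivity), mul_comm, ← abs_of_pos Real.two_pi_pos, ← abs_mul]
    exact hsupp η h j
  have hsmooth : ContDiff ℝ (⊤ : ℕ∞) (𝓕 f) := Real.contDiff_fourier fun n _ => hmoment n
  set G : 𝓢(EuclideanSpace ℝ (Fin d), ℂ) := hcs.toSchwartzMap hsmooth with hG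
  have hGf : (G : EuclideanSpace ℝ (Fin d) → ℂ) = 𝓕 f := rfl
  refine ⟨𝓕⁻ G, ?_, ?_⟩
  · rw [SchwartzMap.fourierInv_coe, hGf]
    exact hcont.fourierInv_fourier_eq hint (by rw [← hGf]; exact G.integrable)
  · unfold BandLimited
    rw [FourierTransform.fourier_fourierInv_eq]
    exact hsupp

/-! ### The zero function and the equivalences -/

lemma supportRadius_le_iff {g : EuclideanSpace ℝ (Fin d) → ℂ} {R : ℝ} (hR : 0 ≤ R) :
    supportRadius g ≤ ENNReal.ofReal R ↔ tsupport g ⊆ cube d R := by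
  simp only [supportRadius, iSup_le_iff, ENNReal.ofReal_le_ofReal_iff hR]
  rfl

lemma tendsto_zero_rpow_inv :
    Tendsto (fun n : ℕ => (0 : ℝ≥0∞) ^ (1 / (n : ℝ))) atTop (𝓝 0) := by
  refine tendsto_const_nhds.congr' ?_
  -- At `n = 0` the exponent `1 / n` is `0` and the term equals `1`, so only `n > 0` is used.
  filter_upwards [eventually_gt_atTop 0] with n hn
  rw [ENNReal.zero_rpow_of_pos (by positivity)]

lemma supportRadius_fourierHat_zero :
    supportRadius (fourierHat (0 : 𝓢(EuclideanSpace ℝ (Fin d), ℂ))) = 0 := by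
  have h : fourierHat (0 : 𝓢(EuclideanSpace ℝ (Fin d), ℂ)) = 0 := by
    ext ξ
    simp [fourierHat]
  rw [h, supportRadius, tsupport_zero]
  simp

end RealPaleyWiener

end

open RealPaleyWiener
theorem corollary3p15 (d : ℕ) (hd : 0 < d) (p q : ℝ≥0∞) (hp : 1 ≤ p) (hq : 1 ≤ q)
    (R : ℝ) (hR : 0 < R) (f : EuclideanSpace ℝ (Fin d) → ℂ) :
    List.TFAE [
      -- (a)
      ∃ F : EuclideanSpace ℂ (Fin d) → ℂ,
        Differentiable ℂ F ∧ (∀ x, F (toComplex x) = f x) ∧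
        ∀ k : ℕ, ∃ C : ℝ, 0 < C ∧ ∀ z : EuclideanSpace ℂ (Fin d),
          ‖F z‖ ≤ C * (1 + ‖z‖) ^ (-(k : ℤ)) * Real.exp (cubeSupportFun R (imPart z)),
      -- (b)
      IsSchwartz f ∧
        ∀ l : ℝ, 0 < l → ∃ C : ℝ, 0 < C ∧
          ∀ (x : EuclideanSpace ℝ (Fin d)) (α : Fin d → ℕ),
            ‖multiD α f x‖ ≤
              C * R ^ multiLength α * ((multiLength α : ℝ) + 1) ^ l * (1 + ‖x‖) ^ (-l),
      -- (c)
      IsSchwartz f ∧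
        Tendsto (fun n : ℕ => maxDerivNorm p f n ^ (1 / (n : ℝ))) atTop
          (𝓝 (supportRadius (fourierHat f))) ∧
        supportRadius (fourierHat f) ≤ ENNReal.ofReal R,
      -- (d)
      IsSchwartz f ∧ tsupport (fourierHat f) ⊆ cube d R,
      -- (e)
      IsSchwartz f ∧
        Tendsto
          (fun n : ℕ =>
            mixedNorm p q (fun x ξ => ((supNorm ξ ^ n : ℝ) : ℂ) * wigner f x ξ) ^ (1 / (n : ℝ)))
          atTop (𝓝 (supportRadius (fourierHat f))) ∧
        supportRadius (fourierHat f) ≤ ENNReal.ofReal R] := by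
  tfae_have 1 → 4 := by
    rintro ⟨F, hF, hFf, hFC⟩
    obtain ⟨g, rfl, hg⟩ := exists_bandLimited_of_entire hF hFf hR.le hFC
    exact ⟨⟨g, rfl⟩, (bandLimited_iff hR.le).1 hg⟩
  tfae_have 4 → 1 := by
    rintro ⟨⟨g, rfl⟩, hg⟩
    have hg' := (bandLimited_iff hR.le).2 hg
    exact ⟨entireExtension g, hg'.differentiable_entireExtension, entireExtension_toComplex g,
      hg'.exists_norm_entireExtension_le hR.le⟩
  tfae_have 4 → 2 := by
    rintro ⟨⟨g, rfl⟩, hg⟩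
    refine ⟨⟨g, rfl⟩, fun l hl => ?_⟩
    obtain ⟨C, hC, h⟩ := ((bandLimited_iff hR.le).2 hg).norm_listD_le_rpow hR hl.le
    refine ⟨C, hC, fun x α => ?_⟩
    rw [multiD_eq_listD, ← length_multiList]
    exact h _ x
  tfae_have 2 → 4 := by
    rintro ⟨⟨g, rfl⟩, h⟩
    obtain ⟨C, -, hC⟩ := h ((d : ℝ) + 1) (by positivity)
    exact ⟨⟨g, rfl⟩, (bandLimited_iff hR.le).1 (bandLimited_of_norm_multiD_le hR ⟨C, hC⟩)⟩
  tfae_have 3 → 4 := fun h => ⟨h.1, (supportRadius_le_iff hR.le).1 h.2.2⟩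
  tfae_have 5 → 4 := fun h => ⟨h.1, (supportRadius_le_iff hR.le).1 h.2.2⟩
  tfae_have 4 → 3 := by
    rintro ⟨⟨g, rfl⟩, hg⟩
    have hg' := (supportRadius_le_iff hR.le).2 hg
    refine ⟨⟨g, rfl⟩, ?_, hg'⟩
    -- The limit is taken at the exact radius `r`, not at `R`. The two-sided bounds need `r > 0`, so
    -- `g = 0` is separate.
    rcases exists_radius hd g (ne_top_of_le_ne_top ENNReal.ofReal_ne_top hg') with
      rfl | ⟨r, hr, hrad, hband, hex⟩
    · simp_rw [maxDerivNorm_zero, supportRadius_fourierHat_zero]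
      exact tendsto_zero_rpow_inv
    · rw [hrad]
      exact hband.tendsto_maxDerivNorm hr hp hex
  tfae_have 4 → 5 := by
    rintro ⟨⟨g, rfl⟩, hg⟩
    have hg' := (supportRadius_le_iff hR.le).2 hg
    refine ⟨⟨g, rfl⟩, ?_, hg'⟩
    rcases exists_radius hd g (ne_top_of_le_ne_top ENNReal.ofReal_ne_top hg') with
      rfl | ⟨r, hr, hrad, hband, hex⟩
    · simp_rw [mixedNorm_wigner_zero, supportRadius_fourierHat_zero]
      exact tendsto_zero_rpow_inv
    · rw [hrad]
      exact hband.tendsto_mixedNorm hr hp hq hex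
  tfae_finish
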